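/- Let $k$ be a field and $H$ a finite-dimensional Hopf algebra over $k$, with comultiplication $\Delta(h)=\sum h_1\otimes h_2$, counit $\varepsilon$ and dual Hopf algebra $H^*$. A twisted $H$-module algebra is a pair $(R,\sigma)$ of an associative $k$-algebra $R$ with unit and a convolution-invertible $\sigma\in\mathrm{Hom}_k(H\otimes H,R)$, together with a linear weak action $H\otimes R\to R$, $h\otimes r\mapsto h\cdot r$, such that $1\cdot r=r$, $h\cdot 1=\varepsilon(h)1$, $h\cdot(rs)=\sum(h_1\cdot r)(h_2\cdot s)$, $h\cdot(l\cdot r)=\sum\sigma(h_1,l_1)(h_2l_2\cdot r)\sigma^{-1}(h_3,l_3)$, $\sigma(1,h)=\sigma(h,1)=\varepsilon(h)1$ and $\sum(h_1\cdot\sigma(l_1,m_1))\,\sigma(h_2,l_2m_2)=\sum\sigma(h_1,l_1)\,\sigma(h_2l_2,m)$. Its crossed product $R\#_\sigma H$ is $R\otimes H$ with the multiplication $(a\#h)(b\#g)=\sum a(h_1\cdot b)\sigma(h_2,g_1)\#h_3g_2$ and unit $1\#1$; it contains $R$ as $R\#1$. For an ideal $I$ of $R$ put $(I:H)=\{x\in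 R\mid h\cdot x\in I\text{ for all }h\in H\}$, and let $I\#_\sigma H$ be the span of the elements $x\#h$ with $x\in I$, $h\in H$. The algebra $R\#_\sigma H$ is an $H^*$-module algebra (a twisted $H^*$-module algebra with trivial cocycle) by $f\cdot(r\#h)=\sum r\#h_1f(h_2)$. Let $r$ be a radical property of associative rings (not necessarily with unit): homomorphic images of $r$-rings are $r$-rings, every ring $A$ has an $r$-ideal $r(A)$ that contains all its $r$-ideals, and $A/r(A)$ has no nonzero $r$-ideal. Suppose that $r$ is hereditary (ideals of $r$-rings are $r$-rings) and that $r(M_n(R))=M_n(r(R))$ for every twisted $H$-module algebra $R$ and every $n$. For a twisted $K$-module algebra $(R,\sigma)$, where $K$ is $H$ or $H^*$, put $$r_K(R)=(r(R):K),\qquad \bar r_K(R)=r(R\#_\sigma K)\cap R,$$ and write $\bar r_K\le r_K$ if $\bar r_K(R)\subseteq r_K(R)$ for every twisted $K$-module algebra $R$. (1) For every twisted $H$-module algebra $(R,\sigma)$, $$r_H(R)\#_\sigma H=\bar r_{H^*}(R\#_\sigma H).$$ Suppose moreover that $\bar r_H\le r_H$ and $\bar r_{H^*}\le r_{H^*}$.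 Then: (2) for every twisted $H$-module algebra $(R,\sigma)$, $\bar r_H(R)=r_H(R)$ and $r_H(R)\#_\sigma H\subseteq r(R\#_\sigma H)$; (3) one has $r(R\#_\sigma H)=0$ for every twisted $H$-module algebra $(R,\sigma)$ with $r_H(R)=0$ if and only if $r(R\#_\sigma H)=r_H(R)\#_\sigma H$ for every twisted $H$-module algebra $(R,\sigma)$. -/

import Mathlib

universe u

noncomputable section

open TensorProduct Coalgebra WithConv

namespace HopfRadical

section Dual
variable (k H : Type u) [Field k] [Ring H] [Bialgebra k H]

/-- The dual `H* = Hom_k(H, k)` with the convolution product `(f g)(x) = ∑ f(x₁) g(x₂)`, whose unit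
is the counit of `H`. For a finite-dimensional Hopf algebra `H` it is made into a Hopf algebra below,
with `∑ f₁(x) f₂(y) = f(x y)`, `ε(f) = f(1)` and antipode `f ↦ f ∘ S`. -/
def DualHopf : Type u := WithConv (H →ₗ[k] k)

namespace DualHopf

instance : Ring (DualHopf k H) := inferInstanceAs (Ring (WithConv (H →ₗ[k] k)))
instance : Algebra k (DualHopf k H) := inferInstanceAs (Algebra k (WithConv (H →ₗ[k] k)))

/-- The linear functional underlying an element of `H*`. -/
def toDual : DualHopf k H ≃ₗ[k] Module.Dual k H where
  toFun f := WithConv.ofConv f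
  invFun f := WithConv.toConv f
  map_add' _ _ := rfl
  map_smul' _ _ := rfl
  left_inv _ := rfl
  right_inv _ := rfl

instance : FunLike (DualHopf k H) H k where
  coe f := toDual k H f
  coe_injective _ _ h := (toDual k H).injective (DFunLike.coe_injective h)

variable {k H}
@[ext] lemma ext {f g : DualHopf k H} (h : ∀ x, f x = g x) : f = g := DFunLike.ext _ _ h
@[simp] lemma toDual_apply (f : DualHopf k H) (x : H) : toDual k H f x = f x := rfl
@[simp] lemma toDual_symm_apply (f : Module.Dual k H) (x : H) : (toDual k H).symm f x = f x := rfl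
@[simp] lemma add_apply (f g : DualHopf k H) (x : H) : (f + g) x = f x + g x := rfl
@[simp] lemma zero_apply (x : H) : (0 : DualHopf k H) x = 0 := rfl
@[simp] lemma smul_apply (c : k) (f : DualHopf k H) (x : H) : (c • f) x = c * f x := rfl
lemma one_apply (x : H) : (1 : DualHopf k H) x = counit x := rfl
lemma algebraMap_apply (c : k) (x : H) : (algebraMap k (DualHopf k H) c) x = c * counit x := rfl
lemma mul_apply (f g : DualHopf k H) (x : H) :
    (f * g) x = LinearMap.mul' k k (TensorProduct.map (toDual k H f) (toDual k H g) (comul x)) := rfl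

variable (k H)
variable [FiniteDimensional k H]

/-- The identification `H* ⊗ H* ≃ (H ⊗ H)*`, `(f ⊗ g)(x ⊗ y) = f(x) g(y)`. -/
def pairing : DualHopf k H ⊗[k] DualHopf k H ≃ₗ[k] Module.Dual k (H ⊗[k] H) :=
  (TensorProduct.congr (toDual k H) (toDual k H)).trans (TensorProduct.dualDistribEquiv k H H)

/-- The identification `H* ⊗ (H* ⊗ H*) ≃ (H ⊗ (H ⊗ H))*`. -/
def pairing₃ : DualHopf k H ⊗[k] (DualHopf k H ⊗[k] DualHopf k H) ≃ₗ[k]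
    Module.Dual k (H ⊗[k] (H ⊗[k] H)) :=
  (TensorProduct.congr (toDual k H) (pairing k H)).trans
    (TensorProduct.dualDistribEquiv k H (H ⊗[k] H))

variable {k H}

@[simp] lemma pairing_tmul (f g : DualHopf k H) (x y : H) :
    pairing k H (f ⊗ₜ g) (x ⊗ₜ y) = f x * g y := by
  simp [pairing]

@[simp] lemma pairing₃_tmul (f : DualHopf k H) (t : DualHopf k H ⊗[k] DualHopf k H)
    (x : H) (y : H ⊗[k] H) :
    pairing₃ k H (f ⊗ₜ t) (x ⊗ₜ y) = f x * pairing k H t y := by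
  simp [pairing₃]

/-- The comultiplication is the transpose of the product of `H`, the counit is evaluation at `1`. -/
instance : CoalgebraStruct k (DualHopf k H) where
  comul := (pairing k H).symm.toLinearMap ∘ₗ
    (LinearMap.lcomp k k (LinearMap.mul' k H)) ∘ₗ (toDual k H).toLinearMap
  counit := LinearMap.applyₗ (1 : H) ∘ₗ (toDual k H).toLinearMap

lemma counit_eq (f : DualHopf k H) : counit (R := k) f = f 1 := rfl

lemma pairing_comul (f : DualHopf k H) :
    pairing k H (comul f) = toDual k H f ∘ₗ LinearMap.mul' k H := by
  simp [comul]; rfl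

@[simp] lemma pairing_comul_tmul (f : DualHopf k H) (x y : H) :
    pairing k H (comul f) (x ⊗ₜ y) = f (x * y) := by
  rw [pairing_comul]; rfl

lemma pairing_lTensor (t : DualHopf k H ⊗[k] DualHopf k H) (x y z : H) :
    pairing₃ k H (comul.lTensor _ t) (x ⊗ₜ (y ⊗ₜ z)) = pairing k H t (x ⊗ₜ (y * z)) := by
  induction t with
  | zero => simp
  | tmul f g => simp
  | add a b ha hb => simp [ha, hb]

lemma pairing_assoc_tmul (t : DualHopf k H ⊗[k] DualHopf k H) (f : DualHopf k H) (x y z : H) :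
    pairing₃ k H (TensorProduct.assoc k _ _ _ (t ⊗ₜ f)) (x ⊗ₜ (y ⊗ₜ z))
      = pairing k H t (x ⊗ₜ y) * f z := by
  induction t with
  | zero => simp
  | tmul f g => simp [mul_assoc]
  | add a b ha hb => simp [ha, hb, add_tmul, add_mul]

lemma pairing_rTensor (t : DualHopf k H ⊗[k] DualHopf k H) (x y z : H) :
    pairing₃ k H (TensorProduct.assoc k _ _ _ (comul.rTensor _ t)) (x ⊗ₜ (y ⊗ₜ z))
      = pairing k H t ((x * y) ⊗ₜ z) := by
  induction t with
  | zero => simp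
  | tmul f g => simp [pairing_assoc_tmul]
  | add a b ha hb => simp [ha, hb]

lemma lid_rTensor_counit (t : DualHopf k H ⊗[k] DualHopf k H) (x : H) :
    TensorProduct.lid k _ (counit.rTensor _ t) x = pairing k H t (1 ⊗ₜ x) := by
  induction t with
  | zero => simp
  | tmul f g => simp [counit_eq]
  | add a b ha hb => simp [ha, hb]

lemma rid_lTensor_counit (t : DualHopf k H ⊗[k] DualHopf k H) (x : H) :
    TensorProduct.rid k _ (counit.lTensor _ t) x = pairing k H t (x ⊗ₜ 1) := by
  induction t with
  | zero => simp
  | tmul f g => simp [counit_eq, mul_comm]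
  | add a b ha hb => simp [ha, hb]

instance : Coalgebra k (DualHopf k H) where
  coassoc := by
    ext1 f
    apply (pairing₃ k H).injective
    ext x y z
    simp [pairing_rTensor, pairing_lTensor, mul_assoc]
  rTensor_counit_comp_comul := by
    ext1 f
    apply (TensorProduct.lid k _).injective
    ext x
    simp [lid_rTensor_counit]
  lTensor_counit_comp_comul := by
    ext1 f
    apply (TensorProduct.rid k _).injective
    ext x
    simp [rid_lTensor_counit]

lemma pairing_mul (s t : DualHopf k H ⊗[k] DualHopf k H) :
    toConv (pairing k H (s * t)) = toConv (pairing k H s) * toConv (pairing k H t) := by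
  induction s with
  | zero => simp
  | add a b ha hb => simp [ha, hb, add_mul]
  | tmul f g =>
    induction t with
    | zero => simp
    | add a b ha hb => simp [ha, hb, mul_add]
    | tmul f' g' =>
      ext x y
      have h (p q : H ⊗[k] H) : (LinearMap.mul' k k)
          (TensorProduct.map (pairing k H (f ⊗ₜ g)) (pairing k H (f' ⊗ₜ g'))
            (TensorProduct.AlgebraTensorModule.tensorTensorTensorComm k k k k H H H H (p ⊗ₜ q)))
          = LinearMap.mul' k k (TensorProduct.map (toDual k H f) (toDual k H f') p) *
            LinearMap.mul' k k (TensorProduct.map (toDual k H g) (toDual k H g') q) := by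
        induction p with
        | zero => simp
        | add a b ha hb => simp only [add_tmul, map_add, ha, hb, add_mul]
        | tmul a b =>
          induction q with
          | zero => simp
          | add a b ha hb => simp only [tmul_add, map_add, ha, hb, mul_add]
          | tmul c d => simp; ring
      simpa [mul_apply] using (h (comul x) (comul y)).symm

instance : Bialgebra k (DualHopf k H) := Bialgebra.mk' k (DualHopf k H)
  (by simp [counit_eq, one_apply])
  (by intro f g; simp [counit_eq, mul_apply, Algebra.TensorProduct.one_def])
  (by
    apply (pairing k H).injective
    ext x y
    simp [Algebra.TensorProduct.one_def, one_apply])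
  (by
    intro f g
    apply (pairing k H).injective
    apply toConv_injective
    rw [pairing_mul, pairing_comul, pairing_comul, pairing_comul]
    exact congrArg toConv
      (LinearMap.convMul_comp_coalgHom_distrib (toConv (toDual k H f)) (toConv (toDual k H g))
        (Bialgebra.mulCoalgHom k H)))

end DualHopf
end Dual

section DualHopfAlgebra
variable {k H : Type u} [Field k] [Ring H] [HopfAlgebra k H]

namespace DualHopf

/-- The antipode `f ↦ f ∘ S` of `H*`. -/
def antipode : DualHopf k H →ₗ[k] DualHopf k H :=
  (toDual k H).symm.toLinearMap ∘ₗ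
    (LinearMap.lcomp k k (HopfAlgebra.antipode k)) ∘ₗ (toDual k H).toLinearMap

lemma antipode_apply (f : DualHopf k H) (x : H) :
    antipode f x = f (HopfAlgebra.antipode k x) := rfl

variable [FiniteDimensional k H]

lemma mul'_rTensor_antipode (t : DualHopf k H ⊗[k] DualHopf k H) (x : H) :
    (LinearMap.mul' k _ (antipode.rTensor _ t)) x =
      pairing k H t ((HopfAlgebra.antipode k).rTensor _ (comul x)) := by
  induction t with
  | zero => simp
  | add a b ha hb => simp [ha, hb]
  | tmul f g => 
    simp only [LinearMap.rTensor_tmul, LinearMap.mul'_apply, mul_apply]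
    generalize (comul x : H ⊗[k] H) = c
    induction c with
    | zero => simp
    | add a b ha hb => simp only [map_add, ha, hb]
    | tmul a b => simp [antipode_apply]

lemma mul'_lTensor_antipode (t : DualHopf k H ⊗[k] DualHopf k H) (x : H) :
    (LinearMap.mul' k _ (antipode.lTensor _ t)) x =
      pairing k H t ((HopfAlgebra.antipode k).lTensor _ (comul x)) := by
  induction t with
  | zero => simp
  | add a b ha hb => simp [ha, hb]
  | tmul f g => 
    simp only [LinearMap.lTensor_tmul, LinearMap.mul'_apply, mul_apply]
    generalize (comul x : H ⊗[k] H) = c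
    induction c with
    | zero => simp
    | add a b ha hb => simp only [map_add, ha, hb]
    | tmul a b => simp [antipode_apply]

instance : HopfAlgebra k (DualHopf k H) where
  antipode := antipode
  mul_antipode_rTensor_comul := by
    ext f x
    simp [mul'_rTensor_antipode, pairing_comul, counit_eq,
      Algebra.algebraMap_eq_smul_one, mul_comm, one_apply]
  mul_antipode_lTensor_comul := by
    ext f x
    simp [mul'_lTensor_antipode, pairing_comul, counit_eq,
      Algebra.algebraMap_eq_smul_one, mul_comm, one_apply]

end DualHopf
end DualHopfAlgebra

section Crossed
/-- A structure of twisted `H`-module algebra `(R, σ)` on a `k`-algebra `R` with unit, for which the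
crossed product `R #_σ H` is an associative algebra with unit `1 # 1`: a weak action of `H` on `R`
and a normalized, convolution-invertible cocycle `σ : H ⊗ H → R` satisfying the twisted module
condition. Products of elements of `WithConv (C →ₗ[k] R)` are convolution products
`(f * g)(c) = ∑ f(c₁) g(c₂)`. -/
structure CrossedSystem (k H R : Type u) [Field k] [Ring H] [Bialgebra k H] [Ring R]
    [Algebra k R] where
  /-- The weak action, `act h r = h · r`. -/
  act : H →ₗ[k] R →ₗ[k] R
  /-- `1 · r = r` -/
  one_act : ∀ r, act 1 r = r
  /-- `h · 1 = ε(h) 1` -/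
  act_one : ∀ h, act h 1 = algebraMap k R (counit h)
  /-- `h · (r s) = ∑ (h₁ · r) (h₂ · s)` -/
  act_mul : ∀ r s, toConv (act.flip (r * s)) = toConv (act.flip r) * toConv (act.flip s)
  /-- The convolution-invertible map `σ : H ⊗ H → R`. -/
  cocycle : (WithConv (H ⊗[k] H →ₗ[k] R))ˣ
  /-- `σ(1, h) = ε(h) 1` -/
  cocycle_one_left : ∀ h, cocycle.val (1 ⊗ₜ h) = algebraMap k R (counit h)
  /-- `σ(h, 1) = ε(h) 1` -/
  cocycle_one_right : ∀ h, cocycle.val (h ⊗ₜ 1) = algebraMap k R (counit h)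
  /-- The twisted module condition `h · (l · r) = ∑ σ(h₁, l₁) (h₂ l₂ · r) σ⁻¹(h₃, l₃)`. -/
  act_act : ∀ r, toConv (TensorProduct.lift (LinearMap.compl₂ act (act.flip r))) =
    cocycle.val * toConv (act.flip r ∘ₗ LinearMap.mul' k H) * cocycle.inv
  /-- The cocycle condition
  `∑ (h₁ · σ(l₁, m₁)) σ(h₂, l₂ m₂) = ∑ σ(h₁, l₁) σ(h₂ l₂, m)`. -/
  cocycle_mul :
    (toConv (TensorProduct.lift (LinearMap.compl₂ act cocycle.val.ofConv)) *
        toConv (cocycle.val.ofConv ∘ₗ (LinearMap.mul' k H).lTensor H) :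
      WithConv (H ⊗[k] (H ⊗[k] H) →ₗ[k] R)) =
    toConv (cocycle.val.ofConv ∘ₗ (TensorProduct.rid k H).toLinearMap.lTensor H ∘ₗ
        ((counit : H →ₗ[k] k).lTensor H).lTensor H) *
      toConv (cocycle.val.ofConv ∘ₗ (LinearMap.mul' k H).rTensor H ∘ₗ
        (TensorProduct.assoc k H H H).symm.toLinearMap)

namespace CrossedSystem
variable {k H R : Type u} [Field k] [Ring H] [Bialgebra k H] [Ring R] [Algebra k R]
variable (S : CrossedSystem k H R)

/-- The crossed product `R #_σ H`: the `k`-module `R ⊗ H` with the multiplication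
`(a # h)(b # g) = ∑ a (h₁ · b) σ(h₂, g₁) # h₃ g₂` and unit `1 # 1` defined below. For an `H`-module
algebra `R` and the trivial cocycle `σ = ε ⊗ ε` it is the smash product `R # H`. -/
def CrossedProduct (_S : CrossedSystem k H R) : Type u := R ⊗[k] H

/-- `r ⊗ 1` -/
abbrev inl : R →ₐ[k] R ⊗[k] H := Algebra.TensorProduct.includeLeft
/-- `1 ⊗ h` -/
abbrev inr : H →ₐ[k] R ⊗[k] H := Algebra.TensorProduct.includeRight

/-- `h ⊗ g ↦ ∑ σ(h₁, g₁) ⊗ h₂ g₂`, the product `(1 # h)(1 # g)`. -/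
def kernel : WithConv (H ⊗[k] H →ₗ[k] R ⊗[k] H) :=
  toConv (inl.toLinearMap ∘ₗ S.cocycle.val.ofConv) *
    toConv (inr.toLinearMap ∘ₗ LinearMap.mul' k H)

/-- `h ⊗ g ↦ (h · b) ε(g)` -/
def actLeft : R →ₗ[k] (H ⊗[k] H →ₗ[k] R) where
  toFun b := S.act.flip b ∘ₗ (TensorProduct.rid k H).toLinearMap ∘ₗ (counit : H →ₗ[k] k).lTensor H
  map_add' _ _ := by ext; simp
  map_smul' _ _ := by ext; simp

/-- `h ⊗ g ↦ ∑ (h₁ · b) σ(h₂, g₁) ⊗ h₃ g₂`, the product `(1 # h)(b # g)`. -/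
def mulAux : R →ₗ[k] (H ⊗[k] H →ₗ[k] R ⊗[k] H) where
  toFun b := (toConv (inl.toLinearMap ∘ₗ S.actLeft b) * S.kernel).ofConv
  map_add' _ _ := by simp [LinearMap.comp_add, add_mul]
  map_smul' _ _ := by simp [LinearMap.comp_smul]

/-- `(a # h)(b # g) = ∑ a (h₁ · b) σ(h₂, g₁) # h₃ g₂`. -/
def mulLin : R ⊗[k] H →ₗ[k] R ⊗[k] H →ₗ[k] R ⊗[k] H :=
  TensorProduct.lift (LinearMap.mk₂ k
    (fun a h => LinearMap.mulLeft k (inl a) ∘ₗ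
      TensorProduct.lift (LinearMap.mk₂ k (fun b g => S.mulAux b (h ⊗ₜ g))
        (by intros; simp) (by intros; simp) (by intros; simp [tmul_add])
        (by intros; simp)))
    (by intros; ext; simp [add_mul, TensorProduct.add_tmul])
    (by intros; ext; simp [← smul_mul_assoc, TensorProduct.smul_tmul'])
    (by intros; ext; simp [TensorProduct.add_tmul, mul_add])
    (by intros; ext; simp [← TensorProduct.smul_tmul']))

lemma mulLin_tmul (a b : R) (h g : H) :
    S.mulLin (a ⊗ₜ h) (b ⊗ₜ g) = (a ⊗ₜ 1) * S.mulAux b (h ⊗ₜ g) := by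
  simp [mulLin]

lemma mulLin_left (a : R) (x y : R ⊗[k] H) :
    S.mulLin ((a ⊗ₜ 1) * x) y = (a ⊗ₜ 1) * S.mulLin x y := by
  induction x with
  | zero => simp
  | add x x' hx hx' => simp [mul_add, hx, hx']
  | tmul b h =>
    induction y with
    | zero => simp
    | add y y' hy hy' => simp only [map_add, mul_add, hy, hy']
    | tmul c g =>
      rw [Algebra.TensorProduct.tmul_mul_tmul, one_mul, mulLin_tmul, mulLin_tmul, ← mul_assoc,
        Algebra.TensorProduct.tmul_mul_tmul, one_mul]

section Conv
variable {C : Type u} [AddCommGroup C] [Module k C] [Coalgebra k C]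

/-- `c ↦ ∑ y(c₁) # p(c₂)` -/
def sharp (y : WithConv (C →ₗ[k] R)) (p : C →ₗ[k] H) : WithConv (C →ₗ[k] R ⊗[k] H) :=
  toConv (inl.toLinearMap ∘ₗ y.ofConv) * toConv (inr.toLinearMap ∘ₗ p)

lemma sharp_apply (y : WithConv (C →ₗ[k] R)) (p : C →ₗ[k] H) (c : C) :
    sharp y p c = TensorProduct.map y.ofConv p (comul c) := by
  simp only [sharp, LinearMap.convMul_apply]
  generalize (comul c : C ⊗[k] C) = t
  induction t with
  | zero => simp
  | add a b ha hb => simp only [map_add, ha, hb]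
  | tmul a b => simp

/-- `c ⊗ h ↦ ε(h) c` -/
def projL : C ⊗[k] H →ₗc[k] C :=
  (Coalgebra.TensorProduct.rid k k C : C ⊗[k] k →ₗc[k] C).comp
    (Coalgebra.TensorProduct.map (CoalgHom.id k C) (Coalgebra.counitCoalgHom k H))

lemma projL_tmul (c : C) (h : H) : projL (k := k) (c ⊗ₜ[k] h) = counit (R := k) h • c := by
  simp [projL]

lemma inl_conv (y z : WithConv (C →ₗ[k] R)) :
    toConv ((inl (H := H)).toLinearMap ∘ₗ (y * z).ofConv) =
      toConv (inl.toLinearMap ∘ₗ y.ofConv) * toConv (inl.toLinearMap ∘ₗ z.ofConv) :=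
  congrArg toConv (LinearMap.algHom_comp_convMul_distrib inl y z)

lemma sharp_comp {D : Type u} [AddCommGroup D] [Module k D] [Coalgebra k D]
    (y : WithConv (C →ₗ[k] R)) (p : C →ₗ[k] H) (q : D →ₗc[k] C) :
    toConv ((sharp y p).ofConv ∘ₗ q.toLinearMap) =
      sharp (toConv (y.ofConv ∘ₗ q.toLinearMap)) (p ∘ₗ q.toLinearMap) := by
  rw [sharp, LinearMap.convMul_comp_coalgHom_distrib]
  rfl

lemma sharp_mul (y z : WithConv (C →ₗ[k] R)) (p : C →ₗ[k] H) :
    sharp (y * z) p = toConv (inl.toLinearMap ∘ₗ y.ofConv) * sharp z p := by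
  rw [sharp, inl_conv, mul_assoc]; rfl

lemma mulAux_eq_sharp (b : R) :
    toConv (S.mulAux b) = sharp (toConv (S.actLeft b) * S.cocycle.val) (LinearMap.mul' k H) := by
  rw [sharp, inl_conv, mul_assoc]; rfl

lemma mulLin_sharp_left (y : WithConv (C →ₗ[k] R)) (p : C →ₗc[k] H) (b : R) (c : C) (g : H) :
    S.mulLin (sharp y p.toLinearMap c) (b ⊗ₜ g) =
      sharp (toConv (y.ofConv ∘ₗ (projL (H := H)).toLinearMap) *
          toConv ((toConv (S.actLeft b) * S.cocycle.val).ofConv ∘ₗ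
            (Coalgebra.TensorProduct.map p (CoalgHom.id k H)).toLinearMap))
        (LinearMap.mul' k H ∘ₗ (Coalgebra.TensorProduct.map p (CoalgHom.id k H)).toLinearMap) (c ⊗ₜ g) := by
  have e : sharp (toConv (y.ofConv ∘ₗ (projL (H := H)).toLinearMap) *
          toConv ((toConv (S.actLeft b) * S.cocycle.val).ofConv ∘ₗ
            (Coalgebra.TensorProduct.map p (CoalgHom.id k H)).toLinearMap))
        (LinearMap.mul' k H ∘ₗ (Coalgebra.TensorProduct.map p (CoalgHom.id k H)).toLinearMap) =
      toConv (inl.toLinearMap ∘ₗ y.ofConv ∘ₗ (projL (H := H)).toLinearMap) *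
        toConv (S.mulAux b ∘ₗ (Coalgebra.TensorProduct.map p (CoalgHom.id k H)).toLinearMap) := by
    rw [sharp_mul, ← sharp_comp, ← mulAux_eq_sharp]
  rw [e, sharp_apply, LinearMap.convMul_apply]
  have key (t : C ⊗[k] C) (w : H ⊗[k] H) :
      S.mulLin (TensorProduct.map y.ofConv p.toLinearMap t)
        (b ⊗ₜ TensorProduct.lid k H (counit.rTensor H w)) =
      LinearMap.mul' k (R ⊗[k] H) (TensorProduct.map
        (inl.toLinearMap ∘ₗ y.ofConv ∘ₗ (projL (H := H)).toLinearMap)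
        (S.mulAux b ∘ₗ (Coalgebra.TensorProduct.map p (CoalgHom.id k H)).toLinearMap)
        (AlgebraTensorModule.tensorTensorTensorComm k k k k C C H H (t ⊗ₜ w))) := by
    induction t with
    | zero => simp
    | add t t' ht ht' => simp only [map_add, add_tmul, LinearMap.add_apply, ht, ht']
    | tmul t t' =>
      induction w with
      | zero => simp
      | add w w' hw hw' => simp only [map_add, tmul_add, hw, hw']
      | tmul w w' =>
        simp [mulLin_tmul, projL_tmul, ← TensorProduct.smul_tmul']
  have := key (comul c) (comul g)
  simp at this
  simpa using this

/-- `h ⊗ c ↦ h · y(c)` -/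
def actConv (y : WithConv (C →ₗ[k] R)) : WithConv (H ⊗[k] C →ₗ[k] R) :=
  toConv (TensorProduct.lift (LinearMap.compl₂ S.act y.ofConv))

lemma act_mul_apply (h : H) (r s : R) : S.act h (r * s) =
    LinearMap.mul' k R (TensorProduct.map (S.act.flip r) (S.act.flip s) (comul h)) := by
  have := congrArg (fun z => z.ofConv h) (S.act_mul r s)
  simpa using this

lemma actConv_mul (y z : WithConv (C →ₗ[k] R)) :
    S.actConv (y * z) = S.actConv y * S.actConv z := by
  ext h c
  have key (t : C ⊗[k] C) (w : H ⊗[k] H) :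
      LinearMap.mul' k R (TensorProduct.map (S.actConv y).ofConv (S.actConv z).ofConv
        (AlgebraTensorModule.tensorTensorTensorComm k k k k H H C C (comul h ⊗ₜ t))) =
      S.act h (LinearMap.mul' k R (TensorProduct.map y.ofConv z.ofConv t)) := by
    induction t with
    | zero => simp
    | add t t' ht ht' => simp only [map_add, tmul_add, ht, ht']
    | tmul t t' =>
      simp only [TensorProduct.map_tmul, LinearMap.mul'_apply, act_mul_apply]
      generalize (comul h : H ⊗[k] H) = w
      induction w with
      | zero => simp
      | add w w' hw hw' => simp only [map_add, add_tmul, hw, hw']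
      | tmul w w' => simp [actConv]
  simpa [actConv] using (key (comul c) 0).symm

lemma mulLin_sharp_right (y : WithConv (C →ₗ[k] R)) (p : C →ₗc[k] H) (h : H) (c : C) :
    S.mulLin (1 ⊗ₜ h) (sharp y p.toLinearMap c) =
      sharp (S.actConv y *
          toConv (S.cocycle.val.ofConv ∘ₗ
            (Coalgebra.TensorProduct.map (CoalgHom.id k H) p).toLinearMap))
        (LinearMap.mul' k H ∘ₗ (Coalgebra.TensorProduct.map (CoalgHom.id k H) p).toLinearMap) (h ⊗ₜ c) := by
  have e : sharp (S.actConv y *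
          toConv (S.cocycle.val.ofConv ∘ₗ
            (Coalgebra.TensorProduct.map (CoalgHom.id k H) p).toLinearMap))
        (LinearMap.mul' k H ∘ₗ (Coalgebra.TensorProduct.map (CoalgHom.id k H) p).toLinearMap) =
      toConv (inl.toLinearMap ∘ₗ (S.actConv y).ofConv) *
        toConv (S.kernel.ofConv ∘ₗ
          (Coalgebra.TensorProduct.map (CoalgHom.id k H) p).toLinearMap) := by
    rw [sharp_mul, ← sharp_comp]
    rfl
  rw [e, sharp_apply, LinearMap.convMul_apply]
  have key0 (b : R) (g : H) : S.mulAux b (h ⊗ₜ g) =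
      LinearMap.mul' k (R ⊗[k] H) (TensorProduct.map (inl.toLinearMap ∘ₗ S.act.flip b)
        (LinearMap.flip (TensorProduct.curry S.kernel.ofConv) g) (comul h)) := by
    have key (t w : H ⊗[k] H) :
        LinearMap.mul' k (R ⊗[k] H) (TensorProduct.map (inl.toLinearMap ∘ₗ S.actLeft b)
          S.kernel.ofConv
          (AlgebraTensorModule.tensorTensorTensorComm k k k k H H H H (t ⊗ₜ w))) =
        LinearMap.mul' k (R ⊗[k] H) (TensorProduct.map (inl.toLinearMap ∘ₗ S.act.flip b)
          (LinearMap.flip (TensorProduct.curry S.kernel.ofConv)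
            (TensorProduct.lid k H (counit.rTensor H w))) t) := by
      induction t with
      | zero => simp
      | add t t' ht ht' => simp only [map_add, add_tmul, ht, ht']
      | tmul t t' =>
        induction w with
        | zero => simp
        | add w w' hw hw' =>
          simp only [map_add, tmul_add, TensorProduct.map_tmul] at hw hw' ⊢
          rw [hw, hw']
          simp [mul_add]
        | tmul w w' => simp [actLeft, TensorProduct.smul_tmul', ]
    have := key (comul h) (comul g)
    simp at this
    simpa [mulAux] using this
  have key (t : C ⊗[k] C) :
      S.mulLin (1 ⊗ₜ h) (TensorProduct.map y.ofConv p.toLinearMap t) =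
      LinearMap.mul' k (R ⊗[k] H) (TensorProduct.map
        (inl.toLinearMap ∘ₗ (S.actConv y).ofConv)
        (S.kernel.ofConv ∘ₗ (Coalgebra.TensorProduct.map (CoalgHom.id k H) p).toLinearMap)
        (AlgebraTensorModule.tensorTensorTensorComm k k k k H H C C (comul h ⊗ₜ t))) := by
    induction t with
    | zero => simp
    | add t t' ht ht' => simp only [map_add, tmul_add, ht, ht']
    | tmul t t' =>
      rw [TensorProduct.map_tmul, mulLin_tmul, key0, ← Algebra.TensorProduct.one_def, one_mul]
      generalize (comul h : H ⊗[k] H) = w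
      induction w with
      | zero => simp
      | add w w' hw hw' => simp only [map_add, add_tmul, hw, hw']
      | tmul w w' => simp [actConv]
  simpa using key (comul c)

end Conv

section Assoc

lemma conv_comp {C D A : Type u} [AddCommGroup C] [Module k C] [Coalgebra k C]
    [AddCommGroup D] [Module k D] [Coalgebra k D] [Ring A] [Algebra k A]
    (f g : WithConv (C →ₗ[k] A)) (q : D →ₗc[k] C) :
    toConv ((f * g).ofConv ∘ₗ q.toLinearMap) =
      toConv (f.ofConv ∘ₗ q.toLinearMap) * toConv (g.ofConv ∘ₗ q.toLinearMap) :=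
  congrArg toConv (LinearMap.convMul_comp_coalgHom_distrib f g q)

/-- `c ↦ ε(c) b` -/
def const {C : Type u} [AddCommGroup C] [Module k C] [Coalgebra k C] (b : R) :
    WithConv (C →ₗ[k] R) :=
  toConv (LinearMap.toSpanSingleton k R b ∘ₗ counit)

lemma sharp_const_mul {C : Type u} [AddCommGroup C] [Module k C] [Coalgebra k C] (b : R)
    (y : WithConv (C →ₗ[k] R)) (p : C →ₗ[k] H) (c : C) :
    sharp (const b * y) p c = (b ⊗ₜ 1) * sharp y p c := by
  rw [sharp_mul, LinearMap.convMul_apply]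
  have key (t : C ⊗[k] C) : LinearMap.mul' k (R ⊗[k] H) (TensorProduct.map
      (inl.toLinearMap ∘ₗ (const b : WithConv (C →ₗ[k] R)).ofConv) (sharp y p).ofConv t) =
      (b ⊗ₜ 1) * sharp y p (TensorProduct.lid k C (counit.rTensor C t)) := by
    induction t with
    | zero => simp
    | add t t' ht ht' => simp only [map_add, mul_add, ht, ht']
    | tmul t t' => simp [const, ← TensorProduct.smul_tmul']
  simpa using key (comul c)

/-- the equation behind `h · (g · c) = ∑ σ (h₁, g₁) (h₂ g₂ · c) σ⁻¹ (h₃, g₃)` -/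
lemma act_act_mul (c : R) :
    toConv (TensorProduct.lift (LinearMap.compl₂ S.act (S.act.flip c))) * S.cocycle.val =
      S.cocycle.val * toConv (S.act.flip c ∘ₗ LinearMap.mul' k H) := by
  rw [S.act_act c, Units.inv_eq_val_inv, mul_assoc, Units.inv_mul, mul_one]

lemma key_identity (b c : R) :
    (toConv ((toConv (S.actLeft b) * S.cocycle.val).ofConv ∘ₗ (projL (H := H)).toLinearMap) *
      toConv ((toConv (S.actLeft c) * S.cocycle.val).ofConv ∘ₗ
        (Coalgebra.TensorProduct.map (Bialgebra.mulCoalgHom k H) (CoalgHom.id k H)).toLinearMap) :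
      WithConv ((H ⊗[k] H) ⊗[k] H →ₗ[k] R)) =
    toConv ((S.actConv (const b * (toConv (S.actLeft c) * S.cocycle.val)) *
      toConv (S.cocycle.val.ofConv ∘ₗ
        (Coalgebra.TensorProduct.map (CoalgHom.id k H)
          (Bialgebra.mulCoalgHom k H)).toLinearMap)).ofConv ∘ₗ
      (Coalgebra.TensorProduct.assoc k k H H H).toCoalgHom.toLinearMap) := by
  have h1 : toConv ((S.actConv (const b)).ofConv ∘ₗ
      (Coalgebra.TensorProduct.assoc k k H H H).toCoalgHom.toLinearMap) =
      toConv (S.actLeft b ∘ₗ (projL (H := H)).toLinearMap) := by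
    ext h g m
    simp [actConv, const, actLeft, projL_tmul, smul_smul, mul_comm]
  have h2 : toConv ((S.actConv (toConv (S.actLeft c))).ofConv ∘ₗ
      (Coalgebra.TensorProduct.assoc k k H H H).toCoalgHom.toLinearMap) =
      toConv (TensorProduct.lift (LinearMap.compl₂ S.act (S.act.flip c)) ∘ₗ
        (projL (H := H)).toLinearMap) := by
    ext h g m
    simp [actConv, actLeft, projL_tmul]
  have h3 : toConv ((S.actConv S.cocycle.val * toConv (S.cocycle.val.ofConv ∘ₗ
        (Coalgebra.TensorProduct.map (CoalgHom.id k H)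
          (Bialgebra.mulCoalgHom k H)).toLinearMap)).ofConv ∘ₗ
      (Coalgebra.TensorProduct.assoc k k H H H).toCoalgHom.toLinearMap) =
      toConv (S.cocycle.val.ofConv ∘ₗ (projL (H := H)).toLinearMap) *
        toConv (S.cocycle.val.ofConv ∘ₗ
        (Coalgebra.TensorProduct.map (Bialgebra.mulCoalgHom k H) (CoalgHom.id k H)).toLinearMap) := by
    have := S.cocycle_mul
    have e : (S.actConv S.cocycle.val * toConv (S.cocycle.val.ofConv ∘ₗ
        (Coalgebra.TensorProduct.map (CoalgHom.id k H)
          (Bialgebra.mulCoalgHom k H)).toLinearMap)) = _ := this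
    rw [e, conv_comp]
    refine congrArg₂ (· * ·) ?_ ?_
    · ext h g m
      simp [projL_tmul]
    · ext h g m
      simp
  have h4 : toConv (S.actLeft c ∘ₗ
        (Coalgebra.TensorProduct.map (Bialgebra.mulCoalgHom k H) (CoalgHom.id k H)).toLinearMap) =
      toConv ((S.act.flip c ∘ₗ LinearMap.mul' k H) ∘ₗ (projL (H := H)).toLinearMap) := by
    ext h g m
    simp [actLeft, projL_tmul]
  have h5 := congrArg (fun z => toConv (z.ofConv ∘ₗ (projL (H := H)).toLinearMap))
    (S.act_act_mul c)
  simp only [conv_comp] at h5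
  rw [actConv_mul, actConv_mul, mul_assoc, mul_assoc, conv_comp, conv_comp, conv_comp,
    conv_comp, h1, h2, h3]
  simp only []
  rw [h4, mul_assoc,
    ← mul_assoc _ _ (toConv (S.cocycle.val.ofConv ∘ₗ
    (Coalgebra.TensorProduct.map (Bialgebra.mulCoalgHom k H) (CoalgHom.id k H)).toLinearMap)),
    ← h5, mul_assoc]

lemma mulLin_one_tmul (b : R) (h g : H) : S.mulLin (1 ⊗ₜ h) (b ⊗ₜ g) =
    sharp (toConv (S.actLeft b) * S.cocycle.val) (LinearMap.mul' k H) (h ⊗ₜ g) := by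
  rw [mulLin_tmul, ← Algebra.TensorProduct.one_def, one_mul, ← mulAux_eq_sharp]

lemma mulLin_assoc (x y z : R ⊗[k] H) :
    S.mulLin (S.mulLin x y) z = S.mulLin x (S.mulLin y z) := by
  induction x with
  | zero => simp
  | add x x' hx hx' => simp only [map_add, LinearMap.add_apply, hx, hx']
  | tmul a h =>
  induction y with
  | zero => simp
  | add y y' hy hy' => simp only [map_add, LinearMap.add_apply, hy, hy']
  | tmul b g =>
  induction z with
  | zero => simp
  | add z z' hz hz' => simp only [map_add, hz, hz']
  | tmul c m =>
  have ha : a ⊗ₜ[k] h = (a ⊗ₜ 1) * (1 ⊗ₜ h) := by simp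
  have hb : b ⊗ₜ[k] g = (b ⊗ₜ 1) * (1 ⊗ₜ g) := by simp
  rw [ha, mulLin_left, mulLin_left, mulLin_left]
  congr 1
  have e1 : S.mulLin (b ⊗ₜ g) (c ⊗ₜ m) =
      sharp (const b * (toConv (S.actLeft c) * S.cocycle.val)) (LinearMap.mul' k H) (g ⊗ₜ m) := by
    rw [hb, mulLin_left, mulLin_one_tmul, sharp_const_mul]
  rw [e1, mulLin_one_tmul]
  have e2 := S.mulLin_sharp_left (toConv (S.actLeft b) * S.cocycle.val)
    (Bialgebra.mulCoalgHom k H) c (h ⊗ₜ g) m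
  have e3 := S.mulLin_sharp_right (const b * (toConv (S.actLeft c) * S.cocycle.val))
    (Bialgebra.mulCoalgHom k H) h (g ⊗ₜ m)
  refine e2.trans (Eq.trans ?_ e3.symm)
  rw [key_identity]
  have hm : (LinearMap.mul' k H ∘ₗ (Coalgebra.TensorProduct.map (Bialgebra.mulCoalgHom k H)
      (CoalgHom.id k H)).toLinearMap) = (LinearMap.mul' k H ∘ₗ (Coalgebra.TensorProduct.map
      (CoalgHom.id k H) (Bialgebra.mulCoalgHom k H)).toLinearMap) ∘ₗ
      (Coalgebra.TensorProduct.assoc k k H H H).toCoalgHom.toLinearMap := by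
    ext; simp [mul_assoc]
  rw [hm, ← sharp_comp]
  rfl

lemma one_mulLin (x : R ⊗[k] H) : S.mulLin 1 x = x := by
  induction x with
  | zero => simp
  | add x x' hx hx' => simp only [map_add, hx, hx']
  | tmul b g =>
    have key (w : H ⊗[k] H) :
        LinearMap.mul' k (R ⊗[k] H) (TensorProduct.map (inl.toLinearMap ∘ₗ S.cocycle.val.ofConv)
          (inr.toLinearMap ∘ₗ LinearMap.mul' k H)
          (AlgebraTensorModule.tensorTensorTensorComm k k k k H H H H ((1 ⊗ₜ 1) ⊗ₜ w))) =
        1 ⊗ₜ (TensorProduct.lid k H (counit.rTensor H w)) := by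
      induction w with
      | zero => simp
      | add w w' hw hw' => simp only [map_add, tmul_add, hw, hw']
      | tmul w w' =>
        simp [S.cocycle_one_left, Algebra.algebraMap_eq_smul_one, TensorProduct.smul_tmul]
    have key' (w : H ⊗[k] H) :
        LinearMap.mul' k (R ⊗[k] H) (TensorProduct.map (inl.toLinearMap ∘ₗ S.actLeft b)
          S.kernel.ofConv
          (AlgebraTensorModule.tensorTensorTensorComm k k k k H H H H ((1 ⊗ₜ 1) ⊗ₜ w))) =
        b ⊗ₜ 1 * S.kernel (1 ⊗ₜ (TensorProduct.lid k H (counit.rTensor H w))) := by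
      induction w with
      | zero => simp
      | add w w' hw hw' => simp only [map_add, tmul_add, mul_add, hw, hw']
      | tmul w w' => simp [actLeft, S.one_act, ← TensorProduct.smul_tmul']
    have h1 := key (comul g)
    have h2 := key' (comul g)
    have h3 : S.kernel (1 ⊗ₜ g) = 1 ⊗ₜ g := by
      simpa [kernel, Algebra.TensorProduct.one_def] using h1
    rw [Algebra.TensorProduct.one_def, mulLin_tmul, ← Algebra.TensorProduct.one_def, one_mul]
    simp only [rTensor_counit_comul, TensorProduct.lid_tmul,
      one_smul, h3] at h2
    simpa [mulAux, Algebra.TensorProduct.one_def] using h2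

lemma mulLin_one (x : R ⊗[k] H) : S.mulLin x 1 = x := by
  induction x with
  | zero => simp
  | add x x' hx hx' => simp only [map_add, LinearMap.add_apply, hx, hx']
  | tmul a h =>
    have key (h : H) (w : H ⊗[k] H) :
        LinearMap.mul' k (R ⊗[k] H) (TensorProduct.map (inl.toLinearMap ∘ₗ S.cocycle.val.ofConv)
          (inr.toLinearMap ∘ₗ LinearMap.mul' k H)
          (AlgebraTensorModule.tensorTensorTensorComm k k k k H H H H (w ⊗ₜ (1 ⊗ₜ 1)))) =
        1 ⊗ₜ (TensorProduct.lid k H (counit.rTensor H w)) := by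
      induction w with
      | zero => simp
      | add w w' hw hw' => simp only [map_add, add_tmul, tmul_add, hw, hw']
      | tmul w w' =>
        simp [S.cocycle_one_right, Algebra.algebraMap_eq_smul_one, TensorProduct.smul_tmul]
    have h3 (h : H) : S.kernel (h ⊗ₜ 1) = 1 ⊗ₜ h := by
      simpa [kernel, Algebra.TensorProduct.one_def] using key h (comul h)
    have key' (w : H ⊗[k] H) :
        LinearMap.mul' k (R ⊗[k] H) (TensorProduct.map (inl.toLinearMap ∘ₗ S.actLeft 1)
          S.kernel.ofConv
          (AlgebraTensorModule.tensorTensorTensorComm k k k k H H H H (w ⊗ₜ (1 ⊗ₜ 1)))) =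
        S.kernel ((TensorProduct.lid k H (counit.rTensor H w)) ⊗ₜ 1) := by
      induction w with
      | zero => simp
      | add w w' hw hw' => simp only [map_add, add_tmul, hw, hw']
      | tmul w w' =>
        rw [AlgebraTensorModule.tensorTensorTensorComm_tmul]
        simp [actLeft, S.act_one, Algebra.algebraMap_eq_smul_one, ← TensorProduct.smul_tmul',
          ← Algebra.TensorProduct.one_def]
    have h2 := key' (comul h)
    simp only [rTensor_counit_comul, TensorProduct.lid_tmul, one_smul, h3] at h2
    rw [Algebra.TensorProduct.one_def, mulLin_tmul]
    have h4 : S.mulAux 1 (h ⊗ₜ 1) = 1 ⊗ₜ h := by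
      simpa [mulAux, Algebra.TensorProduct.one_def] using h2
    rw [h4]; simp

end Assoc

/-- `r # h` -/
def tmul (r : R) (h : H) : S.CrossedProduct := r ⊗ₜ[k] h

instance : AddCommGroup S.CrossedProduct := inferInstanceAs (AddCommGroup (R ⊗[k] H))
instance : Module k S.CrossedProduct := inferInstanceAs (Module k (R ⊗[k] H))

instance : Ring S.CrossedProduct where
  __ := (inferInstance : AddCommGroup S.CrossedProduct)
  mul x y := S.mulLin x y
  one := S.tmul 1 1
  left_distrib x y z := (S.mulLin x).map_add y z
  right_distrib x y z := LinearMap.map_add₂ S.mulLin x y z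
  zero_mul x := LinearMap.map_zero₂ S.mulLin x
  mul_zero x := (S.mulLin x).map_zero
  mul_assoc := S.mulLin_assoc
  one_mul := S.one_mulLin
  mul_one := S.mulLin_one

instance : Algebra k S.CrossedProduct := Algebra.ofModule
  (fun c x y => LinearMap.map_smul₂ S.mulLin c x y)
  (fun c x y => (S.mulLin x).map_smul c y)

lemma mul_def (x y : S.CrossedProduct) : x * y = S.mulLin x y := rfl

lemma tmul_mul_tmul (a b : R) (h g : H) : S.tmul a h * S.tmul b g =
    (a ⊗ₜ[k] (1 : H)) * S.mulAux b (h ⊗ₜ g) := CrossedSystem.mulLin_tmul S a b h g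


section DualAction

/-- `f ⇀ (r ⊗ h) = ∑ r ⊗ h₁ f(h₂)` -/
def dualActAux : DualHopf k H →ₗ[k] R ⊗[k] H →ₗ[k] R ⊗[k] H where
  toFun f := LinearMap.lTensor R
    ((TensorProduct.rid k H).toLinearMap ∘ₗ (DualHopf.toDual k H f).lTensor H ∘ₗ comul)
  map_add' f g := by
    rw [map_add, LinearMap.lTensor_add, LinearMap.add_comp, LinearMap.comp_add,
      LinearMap.lTensor_add]
  map_smul' c f := by
    rw [map_smul, LinearMap.lTensor_smul, LinearMap.smul_comp, LinearMap.comp_smul,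
      LinearMap.lTensor_smul, RingHom.id_apply]

lemma dualActAux_tmul (f : DualHopf k H) (r : R) (h : H) :
    dualActAux f (r ⊗ₜ h) =
      r ⊗ₜ[k] (TensorProduct.rid k H ((DualHopf.toDual k H f).lTensor H (comul h))) := rfl

lemma dualActAux_left (f : DualHopf k H) (a : R) (x : R ⊗[k] H) :
    dualActAux f ((a ⊗ₜ 1) * x) = (a ⊗ₜ 1) * dualActAux f x := by
  induction x with
  | zero => simp
  | add x y hx hy => simp only [mul_add, map_add, hx, hy]
  | tmul b h => simp [dualActAux_tmul]

lemma dualAct_sharp {C : Type u} [AddCommGroup C] [Module k C] [Coalgebra k C]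
    (f : DualHopf k H) (y : WithConv (C →ₗ[k] R)) (p : C →ₗc[k] H) (c : C) :
    dualActAux f (sharp y p.toLinearMap c) =
      TensorProduct.rid k (R ⊗[k] H) (TensorProduct.map (sharp y p.toLinearMap).ofConv
        (DualHopf.toDual k H f ∘ₗ p.toLinearMap) (comul c)) := by
  have e1 : (sharp y p.toLinearMap).ofConv = TensorProduct.map y.ofConv p.toLinearMap ∘ₗ comul := by
    ext c; exact sharp_apply y _ c
  let L : C ⊗[k] (C ⊗[k] C) →ₗ[k] R ⊗[k] H := TensorProduct.map y.ofConv
    ((TensorProduct.rid k H).toLinearMap ∘ₗ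
      TensorProduct.map p.toLinearMap (DualHopf.toDual k H f ∘ₗ p.toLinearMap))
  have e2 : (TensorProduct.rid k (R ⊗[k] H)).toLinearMap ∘ₗ
      TensorProduct.map (TensorProduct.map y.ofConv p.toLinearMap)
        (DualHopf.toDual k H f ∘ₗ p.toLinearMap) =
      L ∘ₗ (TensorProduct.assoc k C C C).toLinearMap := by
    ext a b c
    simp [L, TensorProduct.smul_tmul']
  have e3 : ((TensorProduct.rid k H).toLinearMap ∘ₗ (DualHopf.toDual k H f).lTensor H ∘ₗ comul)
      ∘ₗ p.toLinearMap = ((TensorProduct.rid k H).toLinearMap ∘ₗ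
      TensorProduct.map p.toLinearMap (DualHopf.toDual k H f ∘ₗ p.toLinearMap)) ∘ₗ comul := by
    rw [LinearMap.comp_assoc, LinearMap.comp_assoc, ← p.map_comp_comul, ← LinearMap.comp_assoc
      comul, LinearMap.lTensor_comp_map, LinearMap.comp_assoc]
  have e4 (t : C ⊗[k] C) : TensorProduct.map (TensorProduct.map y.ofConv p.toLinearMap ∘ₗ comul)
      (DualHopf.toDual k H f ∘ₗ p.toLinearMap) t =
      TensorProduct.map (TensorProduct.map y.ofConv p.toLinearMap)
        (DualHopf.toDual k H f ∘ₗ p.toLinearMap) (LinearMap.rTensor C comul t) := by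
    rw [← LinearMap.comp_apply, LinearMap.map_comp_rTensor]
  rw [sharp_apply, e1, e4]
  have e5 := LinearMap.congr_fun e2 (LinearMap.rTensor C comul (comul c))
  refine Eq.trans ?_ e5.symm
  rw [LinearMap.comp_apply, LinearEquiv.coe_coe, Coalgebra.coassoc_apply]
  change LinearMap.lTensor R _ (TensorProduct.map y.ofConv p.toLinearMap (comul c)) = _
  rw [← LinearMap.comp_apply, LinearMap.lTensor_comp_map, e3]
  simp only [L]
  rw [← LinearMap.comp_apply, ← LinearMap.comp_apply, ← LinearMap.comp_apply,
    LinearMap.comp_assoc, ← LinearMap.comp_assoc, LinearMap.map_comp_lTensor]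

lemma dualActAux_one_apply (x : R ⊗[k] H) : dualActAux (1 : DualHopf k H) x = x := by
  induction x with
  | zero => simp
  | add x y hx hy => simp only [map_add, hx, hy]
  | tmul a h =>
    have : DualHopf.toDual k H 1 = counit := rfl
    rw [dualActAux_tmul, this]
    simp

lemma dualActAux_one (f : DualHopf k H) :
    dualActAux f (1 : R ⊗[k] H) = f 1 • 1 := by
  rw [Algebra.TensorProduct.one_def, dualActAux_tmul]
  simp [Algebra.TensorProduct.one_def]

variable [FiniteDimensional k H]

lemma dualActAux_mul (f : DualHopf k H) (x y : R ⊗[k] H) :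
    dualActAux f (S.mulLin x y) = TensorProduct.lift S.mulLin
      (TensorProduct.map (dualActAux.flip x) (dualActAux.flip y) (comul f)) := by
  induction x with
  | zero => simp
  | add x x' hx hx' =>
    simp only [map_add, LinearMap.add_apply, hx, hx', TensorProduct.map_add_left]
  | tmul a h =>
  induction y with
  | zero => simp
  | add y y' hy hy' => simp only [map_add, hy, hy', TensorProduct.map_add_right,
      LinearMap.add_apply]
  | tmul b g =>
  have e1 (h g : H) : S.mulLin (a ⊗ₜ h) (b ⊗ₜ g) = (a ⊗ₜ 1) *
      sharp (toConv (S.actLeft b) * S.cocycle.val) (Bialgebra.mulCoalgHom k H).toLinearMap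
        (h ⊗ₜ g) := by
    rw [mulLin_tmul, ← ofConv_toConv (S.mulAux b), mulAux_eq_sharp]
    rfl
  rw [e1, dualActAux_left, dualAct_sharp]
  have key (t : DualHopf k H ⊗[k] DualHopf k H) : TensorProduct.lift S.mulLin
      (TensorProduct.map (dualActAux.flip (a ⊗ₜ h)) (dualActAux.flip (b ⊗ₜ g)) t) =
      (a ⊗ₜ 1) * TensorProduct.rid k (R ⊗[k] H) (TensorProduct.map
        (sharp (toConv (S.actLeft b) * S.cocycle.val)
          (Bialgebra.mulCoalgHom k H).toLinearMap).ofConv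
        (DualHopf.pairing k H t) (comul (h ⊗ₜ[k] g))) := by
    induction t with
    | zero => simp
    | add t t' ht ht' => simp only [map_add, ht, ht', TensorProduct.map_add_right,
        LinearMap.add_apply, mul_add]
    | tmul p q =>
      simp only [TensorProduct.map_tmul, TensorProduct.lift.tmul, LinearMap.flip_apply,
        dualActAux_tmul, TensorProduct.comul_tmul]
      generalize (comul h : H ⊗[k] H) = u
      generalize (comul g : H ⊗[k] H) = v
      induction u with
      | zero => simp
      | add u u' hu hu' => simp only [map_add, tmul_add, add_tmul, LinearMap.add_apply, mul_add,
          hu, hu']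
      | tmul u u' =>
        induction v with
        | zero => simp
        | add v v' hv hv' => simp only [map_add, tmul_add, mul_add, hv, hv']
        | tmul v v' =>
          rw [AlgebraTensorModule.tensorTensorTensorComm_tmul]
          simp [e1, smul_smul, mul_comm]
  rw [key, DualHopf.pairing_comul]
  rfl

lemma dualActAux_mul_left (f g : DualHopf k H) (x : R ⊗[k] H) :
    dualActAux (f * g) x = dualActAux f (dualActAux g x) := by
  induction x with
  | zero => simp
  | add x y hx hy => simp only [map_add, hx, hy]
  | tmul a h =>
    simp only [dualActAux_tmul]
    congr 1
    have k1 (t : H ⊗[k] H) : TensorProduct.rid k H ((DualHopf.toDual k H f).lTensor H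
        (comul (TensorProduct.rid k H ((DualHopf.toDual k H g).lTensor H t)))) =
        TensorProduct.rid k H ((LinearMap.mul' k k ∘ₗ TensorProduct.map (DualHopf.toDual k H f)
          (DualHopf.toDual k H g)).lTensor H
          (TensorProduct.assoc k H H H (LinearMap.rTensor H comul t))) := by
      induction t with
      | zero => simp
      | add s t hs ht => simp only [map_add, hs, ht]
      | tmul u v =>
        simp only [LinearMap.lTensor_tmul, LinearMap.rTensor_tmul, TensorProduct.rid_tmul, map_smul]
        generalize (comul u : H ⊗[k] H) = w
        induction w with
        | zero => simp
        | add s t hs ht => simp only [map_add, add_tmul, smul_add, hs, ht]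
        | tmul u' v' => simp [smul_smul, mul_comm]
    rw [k1, coassoc_apply, ← LinearMap.lTensor_comp_apply]
    rfl

/-- The action of `H*` on `R #_σ H`, `f ⇀ (r # h) = ∑ r # h₁ f(h₂)`. -/
def dualAct : DualHopf k H →ₗ[k] S.CrossedProduct →ₗ[k] S.CrossedProduct :=
  (dualActAux : DualHopf k H →ₗ[k] R ⊗[k] H →ₗ[k] R ⊗[k] H)

lemma dualAct_one (f : DualHopf k H) :
    S.dualAct f 1 = algebraMap k S.CrossedProduct (counit f) := by
  rw [Algebra.algebraMap_eq_smul_one]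
  exact dualActAux_one f

lemma dualAct_mul (f : DualHopf k H) (x y : S.CrossedProduct) :
    S.dualAct f (x * y) = LinearMap.mul' k S.CrossedProduct
      (TensorProduct.map (S.dualAct.flip x) (S.dualAct.flip y) (comul f)) :=
  S.dualActAux_mul f x y

/-- The `H*`-module algebra `R #_σ H` as a twisted `H*`-module algebra with trivial cocycle, so that
`S.dual.CrossedProduct` is the smash product `(R #_σ H) # H*`. -/
def dual : CrossedSystem k (DualHopf k H) S.CrossedProduct where
  act := S.dualAct
  one_act := dualActAux_one_apply
  act_one := S.dualAct_one
  act_mul x y := by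
    ext f
    exact S.dualAct_mul f x y
  cocycle := 1
  cocycle_one_left h := by simp
  cocycle_one_right h := by simp
  act_act x := by
    rw [Units.inv_eq_val_inv, inv_one, Units.val_one, one_mul, mul_one]
    ext f g
    exact (dualActAux_mul_left f g x).symm
  cocycle_mul := by
    have h1 : toConv (TensorProduct.lift (LinearMap.compl₂ S.dualAct
        (1 : WithConv (DualHopf k H ⊗[k] DualHopf k H →ₗ[k] S.CrossedProduct)).ofConv)) = 1 := by
      ext f g h
      simp [dualAct_one, Algebra.algebraMap_eq_smul_one, smul_smul]
    have h2 : toConv ((1 : WithConv (DualHopf k H ⊗[k] DualHopf k H →ₗ[k] S.CrossedProduct)).ofConv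
        ∘ₗ (LinearMap.mul' k (DualHopf k H)).lTensor (DualHopf k H)) = 1 := by
      ext f g h
      simp [Algebra.algebraMap_eq_smul_one, smul_smul, mul_comm, mul_left_comm]
    have h3 : toConv ((1 : WithConv (DualHopf k H ⊗[k] DualHopf k H →ₗ[k] S.CrossedProduct)).ofConv
        ∘ₗ (LinearMap.mul' k (DualHopf k H)).rTensor (DualHopf k H) ∘ₗ
        (TensorProduct.assoc k _ _ _).symm.toLinearMap) = 1 := by
      ext f g h
      simp [Algebra.algebraMap_eq_smul_one, smul_smul, mul_comm, mul_left_comm]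
    have h4 : toConv ((1 : WithConv (DualHopf k H ⊗[k] DualHopf k H →ₗ[k] S.CrossedProduct)).ofConv
        ∘ₗ (TensorProduct.rid k (DualHopf k H)).toLinearMap.lTensor (DualHopf k H) ∘ₗ
        ((counit : DualHopf k H →ₗ[k] k).lTensor (DualHopf k H)).lTensor (DualHopf k H)) = 1 := by
      ext f g h
      simp [Algebra.algebraMap_eq_smul_one, smul_smul, mul_comm, mul_left_comm]
    rw [Units.val_one, h1, h2, h3, h4]

/-- The embedding `R → R #_σ H`, `r ↦ r # 1`, through which `R` is a subring of `R #_σ H`. -/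
def incl : R →+* S.CrossedProduct where
  toFun r := S.tmul r 1
  map_one' := rfl
  map_zero' := zero_tmul _ _
  map_add' _ _ := add_tmul _ _ _
  map_mul' a b := by
    have h : S.mulAux b (1 ⊗ₜ 1) = b ⊗ₜ 1 := by
      have := S.one_mulLin (b ⊗ₜ 1)
      rwa [Algebra.TensorProduct.one_def, mulLin_tmul, ← Algebra.TensorProduct.one_def,
        one_mul] at this
    rw [tmul_mul_tmul, h, Algebra.TensorProduct.tmul_mul_tmul, one_mul]
    rfl

end DualAction

/-- The ideal `(I : H) = {x | h · x ∈ I for all h ∈ H}`. -/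
def colon (I : TwoSidedIdeal R) : TwoSidedIdeal R :=
  TwoSidedIdeal.mk' {x | ∀ h, S.act h x ∈ I}
    (fun h => by rw [map_zero]; exact I.zero_mem)
    (fun hx hy h => by rw [map_add]; exact I.add_mem (hx h) (hy h))
    (fun hx h => by rw [map_neg]; exact I.neg_mem (hx h))
    (fun {x y} hy h => by
      rw [act_mul_apply]
      generalize (comul h : H ⊗[k] H) = t
      induction t with
      | zero => rw [map_zero, map_zero]; exact I.zero_mem
      | add s t hs ht => rw [map_add, map_add]; exact I.add_mem hs ht
      | tmul a b => exact I.mul_mem_left _ _ (hy b))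
    (fun {x y} hx h => by
      rw [act_mul_apply]
      generalize (comul h : H ⊗[k] H) = t
      induction t with
      | zero => rw [map_zero, map_zero]; exact I.zero_mem
      | add s t hs ht => rw [map_add, map_add]; exact I.add_mem hs ht
      | tmul a b => exact I.mul_mem_right _ _ (hx a))

/-- `I #_σ H`, the set of all sums of elements `r # h` of `R #_σ H` with `r ∈ I` and `h ∈ H`. -/
def smash (I : TwoSidedIdeal R) : Submodule k S.CrossedProduct :=
  Submodule.span k {x | ∃ r ∈ I, ∃ h : H, x = S.tmul r h}

end CrossedSystem
end Crossed

section Radical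

/-- A (Kurosh-Amitsur) radical property for associative rings, not necessarily with unit: an ideal
is an `r`-ideal if, as a ring, it has the property `prop`. -/
structure RadicalProperty where
  /-- The class of `r`-rings. -/
  prop : ∀ (A : Type u) [NonUnitalRing A], Prop
  /-- Homomorphic images of `r`-rings are `r`-rings. -/
  image : ∀ (A B : Type u) [NonUnitalRing A] [NonUnitalRing B] (f : A →ₙ+* B),
    Function.Surjective f → prop A → prop B
  /-- Every ring has an `r`-ideal that contains all `r`-ideals. -/
  exists_greatest : ∀ (A : Type u) [NonUnitalRing A],
    ∃ I, IsGreatest {I : TwoSidedIdeal A | prop I} I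
  /-- The quotient of a ring by its greatest `r`-ideal has no nonzero `r`-ideals. -/
  quotient : ∀ (A : Type u) [NonUnitalRing A] (I : TwoSidedIdeal A),
    IsGreatest {I : TwoSidedIdeal A | prop I} I →
      ∀ J : TwoSidedIdeal I.ringCon.Quotient, prop J → J = ⊥

namespace RadicalProperty
variable (r : RadicalProperty.{u})

/-- The radical `r(A)`: the greatest `r`-ideal of `A`. -/
def rad (A : Type u) [NonUnitalRing A] : TwoSidedIdeal A := (r.exists_greatest A).choose

/-- Ideals of `r`-rings are `r`-rings. -/
def IsHereditary : Prop :=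
  ∀ (A : Type u) [NonUnitalRing A], r.prop A → ∀ I : TwoSidedIdeal A, r.prop I

/-- `r(M_n(R)) = M_n(r(R))` for every twisted `H`-module algebra `R` and every `n`. -/
def MatrixCondition (k H : Type u) [Field k] [Ring H] [Bialgebra k H] : Prop :=
  ∀ (R : Type u) [Ring R] [Algebra k R] (_S : CrossedSystem k H R) (n : ℕ),
    r.rad (Matrix (Fin n) (Fin n) R) = (r.rad R).matrix (Fin n)

section
variable {k H R : Type u} [Field k] [Ring H] [Bialgebra k H] [Ring R] [Algebra k R]

/-- `r_H(R) = (r(R) : H)` -/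
def radH (S : CrossedSystem k H R) : TwoSidedIdeal R := S.colon (r.rad R)

/-- `r̄_H(R) = r(R #_σ H) ∩ R` -/
def barRadH (S : CrossedSystem k H R) : TwoSidedIdeal R :=
  (r.rad S.CrossedProduct).comap S.incl

end

/-- `r̄_H ≤ r_H`, that is `r̄_H(R) ⊆ r_H(R)` for every twisted `H`-module algebra `R`. -/
def BarRadHLe (k H : Type u) [Field k] [Ring H] [Bialgebra k H] : Prop :=
  ∀ (R : Type u) [Ring R] [Algebra k R] (S : CrossedSystem k H R), r.barRadH S ≤ r.radH S

end RadicalProperty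

end Radical

end HopfRadical

end

/-! Write `A = R #_σ H` and `γ(h) = 1 # h`. The engine is duality for crossed products: `A # H*` is
the matrix ring `M_n(R)`, `n = dim H`. The ring `A # H*` acts on `A` from the right, `a # f` sending
`x` to `S⁻¹(f) ⇀ (x a)`, and this action commutes with left multiplication by `R`. As `A` is free
over `R` on the elements `γ(e_i)`, for a basis `e_i` of `H`, the action is given by matrices over
`R` (`dualityEquiv`). That every matrix occurs exactly once rests on two facts: `γ` is
convolution-invertible (`isUnit_gamma`), and the antipode of `H*` is bijective
(`antipode_bijective`).

Under the duality `a # 1` becomes the matrix of coordinates of the products `γ(e_i) a`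
(`dualityEquiv_incl`). The matrix hypothesis on `r` therefore says that `a` lies in `r(A # H*)`
exactly when all `γ(h) a` lie in `r(R) #_σ H`. By `gamma_mul_mem_smash_iff` such `a` form `(r(R) :
H) #_σ H`, which is (1).

For (2), (1) and the inequality for `H*` put `r_H(R) #_σ H` inside `r_{H*}(A)`, hence inside `r(A)`
because the unit of `H*` acts as the identity. Intersecting with `R` gives `r_H ≤ r̄_H`, and the
inequality for `H` is the converse.

For (3), pass to `Q = R / r_H(R)`, again a twisted module algebra since `(I : H)` is stable under
`H`. The kernel of `A → Q #_σ H` is `r_H(R) #_σ H`, which lies in `r(A)` by (2), so `r(A)` is the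
preimage of `r(Q #_σ H)` (`map_mem_rad_iff`). Intersecting with coefficients shows `r_H(Q) = 0`; if
this forces `r(Q #_σ H) = 0`, then `r(A)` is that kernel. -/

noncomputable section

open TensorProduct Coalgebra WithConv

namespace HopfRadical

/-! ### Bijectivity of the antipode of a finite-dimensional Hopf algebra -/

section AntipodeBijective
variable {k H : Type u} [Field k] [Ring H] [HopfAlgebra k H]

/-- `x ↦ x h` -/
def rightMul : H →ₗ[k] Module.End k H := (LinearMap.mul k H).flip

/-- `x ↦ ∑ x₁ f(x₂)` -/
def hitRight : Module.Dual k H →ₗ[k] Module.End k H where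
  toFun f := (TensorProduct.rid k H).toLinearMap ∘ₗ f.lTensor H ∘ₗ comul
  map_add' f g := by ext; simp [LinearMap.lTensor_add]
  map_smul' c f := by ext; simp [LinearMap.lTensor_smul]

/-- `x ↦ ∑ f(x₁) x₂` -/
def hitLeft : Module.Dual k H →ₗ[k] Module.End k H where
  toFun f := (TensorProduct.lid k H).toLinearMap ∘ₗ f.rTensor H ∘ₗ comul
  map_add' f g := by ext; simp [LinearMap.rTensor_add]
  map_smul' c f := by ext; simp [LinearMap.rTensor_smul]

/-- `g ↦ (x ↦ f(x g))` -/
def translate (f : Module.Dual k H) : H →ₗ[k] Module.Dual k H :=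
  (LinearMap.mul k H).flip.compr₂ f

@[simp] lemma rightMul_apply (h x : H) : rightMul (k := k) h x = x * h := rfl
lemma hitRight_apply (f : Module.Dual k H) (x : H) :
    hitRight f x = TensorProduct.rid k H (f.lTensor H (comul x)) := rfl
lemma hitLeft_apply (f : Module.Dual k H) (x : H) :
    hitLeft f x = TensorProduct.lid k H (f.rTensor H (comul x)) := rfl
@[simp] lemma translate_apply (f : Module.Dual k H) (g x : H) : translate f g x = f (x * g) := rfl

/-- The Heisenberg-type commutation rule, read off from `Δ(xg) = Δ(x)Δ(g)`: both sides send `x` to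
`∑ x₁ g₁ f(x₂ g₂)`. It brings products of operators into the order used by `hitRightMul`. -/
lemma hitRight_mul_rightMul (f : Module.Dual k H) (g : H) : hitRight f * rightMul g =
    LinearMap.mul' k _ (TensorProduct.map rightMul (hitRight ∘ₗ translate f) (comul g)) := by
  ext x
  have key (t : H ⊗[k] H) : TensorProduct.rid k H (f.lTensor H (comul x * t)) =
      LinearMap.mul' k (Module.End k H)
        (TensorProduct.map rightMul (hitRight ∘ₗ translate f) t) x := by
    induction t with
    | zero => simp
    | add s t hs ht => simp only [mul_add, map_add, hs, ht, LinearMap.add_apply]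
    | tmul a b =>
      simp only [TensorProduct.map_tmul, LinearMap.mul'_apply, Module.End.mul_apply,
        rightMul_apply, LinearMap.comp_apply, hitRight_apply]
      generalize (comul x : H ⊗[k] H) = s
      induction s with
      | zero => simp
      | add s t hs ht => simp only [add_mul, map_add, hs, ht]
      | tmul c d => simp
  rw [← key, Module.End.mul_apply, hitRight_apply, rightMul_apply, Bialgebra.comul_mul]

/-- This is `∑ Δ(S(h₁)) (h₂ ⊗ 1) = 1 ⊗ S(h)`. Both sides are convolution inverses of `h ↦ 1 ⊗ h`,
one on the left and one on the right, because `Δ` is the convolution product of the two inclusions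
and `Δ ∘ S` is its left inverse. -/
lemma comul_antipode_mul_includeLeft :
    (toConv (comul ∘ₗ HopfAlgebra.antipode k) *
      toConv (Algebra.TensorProduct.includeLeft : H →ₐ[k] H ⊗[k] H).toLinearMap :
        WithConv (H →ₗ[k] H ⊗[k] H)) =
    toConv ((Algebra.TensorProduct.includeRight : H →ₐ[k] H ⊗[k] H).toLinearMap ∘ₗ
      HopfAlgebra.antipode k) := by
  set l : WithConv (H →ₗ[k] H ⊗[k] H) :=
    toConv (Algebra.TensorProduct.includeLeft : H →ₐ[k] H ⊗[k] H).toLinearMap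
  set r : WithConv (H →ₗ[k] H ⊗[k] H) :=
    toConv (Algebra.TensorProduct.includeRight : H →ₐ[k] H ⊗[k] H).toLinearMap
  have h1 : l * r = toConv comul := by
    ext x
    rw [LinearMap.convMul_apply]
    generalize (comul x : H ⊗[k] H) = t
    induction t with
    | zero => simp
    | add s t hs ht => simp only [map_add, hs, ht]
    | tmul a b => simp [l, r]
  have one_comp (A B : Type u) [Ring A] [Ring B] [Algebra k A] [Algebra k B] (φ : A →ₐ[k] B) :
      toConv (φ.toLinearMap ∘ₗ (1 : WithConv (H →ₗ[k] A)).ofConv) = 1 := by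
    ext x; simp
  have h2 : toConv (comul ∘ₗ HopfAlgebra.antipode k) * toConv comul =
      (1 : WithConv (H →ₗ[k] H ⊗[k] H)) := by
    rw [← one_comp _ _ (Bialgebra.comulAlgHom k H), ← LinearMap.antipode_mul_id,
      LinearMap.algHom_comp_convMul_distrib]
    rfl
  have h3 : r * toConv ((Algebra.TensorProduct.includeRight : H →ₐ[k] H ⊗[k] H).toLinearMap ∘ₗ
      HopfAlgebra.antipode k) = 1 := by
    rw [← one_comp _ _ (Algebra.TensorProduct.includeRight : H →ₐ[k] H ⊗[k] H),
      ← LinearMap.id_mul_antipode, LinearMap.algHom_comp_convMul_distrib]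
    rfl
  rw [← h1, ← mul_assoc] at h2
  exact left_inv_eq_right_inv h2 h3

/-- The mirror image of `hitRight_mul_rightMul`, with `S(g)` in place of `g` and the composition
reversed. The factor `∑ Δ(S(g₁)) (g₂ ⊗ 1)` that appears collapses to `1 ⊗ S(g)`. -/
lemma rightMul_antipode_mul_hitLeft (f : Module.Dual k H) (g : H) :
    rightMul (HopfAlgebra.antipode k g) * hitLeft f =
    LinearMap.mul' k _ (TensorProduct.map (hitLeft ∘ₗ translate f)
      (rightMul ∘ₗ HopfAlgebra.antipode k) (TensorProduct.comm k H H (comul g))) := by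
  ext x
  have key (t : H ⊗[k] H) : TensorProduct.lid k H (f.rTensor H (comul x *
      LinearMap.mul' k _ (TensorProduct.map (comul ∘ₗ HopfAlgebra.antipode k)
        (Algebra.TensorProduct.includeLeft : H →ₐ[k] H ⊗[k] H).toLinearMap t))) =
      LinearMap.mul' k (Module.End k H) (TensorProduct.map (hitLeft ∘ₗ translate f)
      (rightMul ∘ₗ HopfAlgebra.antipode k) (TensorProduct.comm k H H t)) x := by
    induction t with
    | zero => simp
    | add s t hs ht => simp only [mul_add, map_add, hs, ht, LinearMap.add_apply]
    | tmul a b =>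
      simp only [TensorProduct.map_tmul, LinearMap.mul'_apply, Module.End.mul_apply,
        rightMul_apply, LinearMap.comp_apply, hitLeft_apply, TensorProduct.comm_tmul,
        Bialgebra.comul_mul, ← mul_assoc]
      generalize (comul x * comul (HopfAlgebra.antipode k a) : H ⊗[k] H) = s
      induction s with
      | zero => simp
      | add s t hs ht => simp only [add_mul, map_add, hs, ht]
      | tmul c d => simp
  have h := congrArg (fun z => z.ofConv g) (comul_antipode_mul_includeLeft (k := k) (H := H))
  simp only [LinearMap.convMul_apply] at h
  rw [← key, h, Module.End.mul_apply, hitLeft_apply, rightMul_apply]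
  simp only [LinearMap.comp_apply, AlgHom.toLinearMap_apply,
    Algebra.TensorProduct.includeRight_apply]
  generalize (comul x : H ⊗[k] H) = s
  induction s with
  | zero => simp
  | add s t hs ht => simp only [add_mul, map_add, hs, ht]
  | tmul c d => simp

lemma hitRight_mul (f g : Module.Dual k H) :
    hitRight f * hitRight g = hitRight (toConv f * toConv g : WithConv (H →ₗ[k] k)).ofConv := by
  ext x
  have k1 (t : H ⊗[k] H) : TensorProduct.rid k H (f.lTensor H
        (comul (TensorProduct.rid k H (g.lTensor H t)))) =
        TensorProduct.rid k H ((LinearMap.mul' k k ∘ₗ TensorProduct.map f g).lTensor H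
          (TensorProduct.assoc k H H H (LinearMap.rTensor H comul t))) := by
      induction t with
      | zero => simp
      | add s t hs ht => simp only [map_add, hs, ht]
      | tmul u v =>
        simp only [LinearMap.lTensor_tmul, LinearMap.rTensor_tmul, TensorProduct.rid_tmul, map_smul]
        generalize (comul u : H ⊗[k] H) = w
        induction w with
        | zero => simp
        | add s t hs ht => simp only [map_add, add_tmul, smul_add, hs, ht]
        | tmul u' v' => simp [smul_smul, mul_comm]
  rw [Module.End.mul_apply, hitRight_apply, hitRight_apply, hitRight_apply, k1, coassoc_apply,
    ← LinearMap.lTensor_comp_apply]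
  rfl

/-- The order of composition is opposite to that in `hitRight_mul`; together with the
antimultiplicativity of `S` this makes `hitLeftMul` reverse the products that `hitRightMul`
respects. -/
lemma hitLeft_mul (f g : Module.Dual k H) :
    hitLeft g * hitLeft f = hitLeft (toConv f * toConv g : WithConv (H →ₗ[k] k)).ofConv := by
  ext x
  have k1 (t : H ⊗[k] H) : TensorProduct.lid k H (g.rTensor H
        (comul (TensorProduct.lid k H (f.rTensor H t)))) =
        TensorProduct.lid k H ((LinearMap.mul' k k ∘ₗ TensorProduct.map f g).rTensor H
          ((TensorProduct.assoc k H H H).symm (LinearMap.lTensor H comul t))) := by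
      induction t with
      | zero => simp
      | add s t hs ht => simp only [map_add, hs, ht]
      | tmul u v =>
        simp only [LinearMap.lTensor_tmul, LinearMap.rTensor_tmul, TensorProduct.lid_tmul, map_smul]
        generalize (comul v : H ⊗[k] H) = w
        induction w with
        | zero => simp
        | add s t hs ht => simp only [map_add, tmul_add, smul_add, hs, ht]
        | tmul u' v' => simp [smul_smul]
  rw [Module.End.mul_apply, hitLeft_apply, hitLeft_apply, hitLeft_apply, k1,
    Coalgebra.coassoc_symm_apply, ← LinearMap.rTensor_comp_apply]
  rfl

lemma rightMul_mul (g h : H) : rightMul (k := k) h * rightMul g = rightMul (g * h) := by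
  ext x; simp [mul_assoc]

/-- `h ⊗ f ↦ (x ↦ ∑ x₁ h f(x₂))` -/
def hitRightMul : H ⊗[k] Module.Dual k H →ₗ[k] Module.End k H :=
  LinearMap.mul' k _ ∘ₗ TensorProduct.map rightMul hitRight

/-- `h ⊗ f ↦ (x ↦ ∑ f(x₁ S(h)₁) x₂ S(h)₂)` -/
def hitLeftMul : H ⊗[k] Module.Dual k H →ₗ[k] Module.End k H :=
  LinearMap.mul' k _ ∘ₗ TensorProduct.map hitLeft (rightMul ∘ₗ HopfAlgebra.antipode k) ∘ₗ
    (TensorProduct.comm k H (Module.Dual k H)).toLinearMap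

/-- The operator attached to `h ⊗ f` is the convolution product of the identity with `x ↦ f(x) h`.
Rank-one maps give `H ⊗ H* ≃ End(H)` in finite dimension, and convolution with the identity is
inverted by the antipode. -/
lemma hitRightMul_bijective [FiniteDimensional k H] :
    Function.Bijective (hitRightMul (k := k) (H := H)) := by
  let e : WithConv (H →ₗ[k] H) ≃ WithConv (H →ₗ[k] H) := Units.mulLeft
    ⟨toConv LinearMap.id, toConv (HopfAlgebra.antipode k), LinearMap.id_mul_antipode,
      LinearMap.antipode_mul_id⟩
  have h : ⇑(hitRightMul (k := k) (H := H)) = WithConv.equiv _ ∘ e ∘ (WithConv.equiv _).symm ∘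
      dualTensorHom k H H ∘ TensorProduct.comm k H (Module.Dual k H) := by
    funext t
    ext x
    have he (z) : e z = toConv LinearMap.id * z := rfl
    simp only [Function.comp_apply, he, WithConv.equiv_apply, WithConv.symm_equiv_apply]
    induction t with
    | zero => simp
    | add s t hs ht =>
      simp only [map_add, LinearMap.add_apply, hs, ht, toConv_add, mul_add, ofConv_add]
    | tmul h f =>
      rw [LinearMap.convMul_apply]
      simp only [hitRightMul, LinearMap.comp_apply, TensorProduct.map_tmul, LinearMap.mul'_apply,
        Module.End.mul_apply, rightMul_apply, hitRight_apply]
      generalize (comul x : H ⊗[k] H) = s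
      induction s with
      | zero => simp
      | add s t hs ht => simp only [add_mul, map_add, hs, ht]
      | tmul c d => simp
  rw [h]
  exact (WithConv.equiv _).bijective.comp (e.bijective.comp ((WithConv.equiv _).symm.bijective.comp
    ((dualTensorHom_bijective).comp (TensorProduct.comm k H (Module.Dual k H)).bijective)))

/-- One and the same `w` serves both families, so the bijection `hitRightMul` transports
`hitLeftMul` to an antihomomorphism on `End(H)`. -/
lemma exists_hitRightMul_mul (s t : H ⊗[k] Module.Dual k H) :
    ∃ w, hitRightMul s * hitRightMul t = hitRightMul w ∧
      hitLeftMul t * hitLeftMul s = hitLeftMul w := by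
  induction s with
  | zero => exact ⟨0, by simp⟩
  | add s s' hs hs' =>
    obtain ⟨w, h1, h2⟩ := hs
    obtain ⟨w', h1', h2'⟩ := hs'
    exact ⟨w + w', by simp [add_mul, h1, h1'], by simp [mul_add, h2, h2']⟩
  | tmul h f =>
    induction t with
    | zero => exact ⟨0, by simp⟩
    | add s s' hs hs' =>
      obtain ⟨w, h1, h2⟩ := hs
      obtain ⟨w', h1', h2'⟩ := hs'
      exact ⟨w + w', by simp [mul_add, h1, h1'], by simp [add_mul, h2, h2']⟩
    | tmul g e =>
      -- The witness is `∑ g₁ h ⊗ (f(· g₂) * e)`, which is what either commutation rule yields.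
      let m : H ⊗[k] H →ₗ[k] H ⊗[k] Module.Dual k H := TensorProduct.map
        (LinearMap.mulRight k h)
        ((WithConv.linearEquiv k (H →ₗ[k] k)).toLinearMap ∘ₗ LinearMap.mulRight k (toConv e) ∘ₗ
          (WithConv.linearEquiv k (H →ₗ[k] k)).symm.toLinearMap ∘ₗ translate f)
      refine ⟨m (comul g), ?_, ?_⟩
      · have : hitRightMul (h ⊗ₜ f) * hitRightMul (g ⊗ₜ e) =
            rightMul h * (hitRight f * rightMul g) * hitRight e := by
          simp [hitRightMul, mul_assoc]
        rw [this, hitRight_mul_rightMul]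
        generalize (comul g : H ⊗[k] H) = t
        induction t with
        | zero => simp
        | add s t hs ht => simp only [map_add, mul_add, add_mul, hs, ht]
        | tmul a b =>
          simp only [m, hitRightMul, TensorProduct.map_tmul, LinearMap.mul'_apply,
            LinearMap.comp_apply, LinearMap.mulRight_apply, ← rightMul_mul, mul_assoc]
          rw [hitRight_mul]; rfl
      · have : hitLeftMul (g ⊗ₜ e) * hitLeftMul (h ⊗ₜ f) =
            hitLeft e * (rightMul (HopfAlgebra.antipode k g) * hitLeft f) *
              rightMul (HopfAlgebra.antipode k h) := by
          simp [hitLeftMul, mul_assoc]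
        rw [this, rightMul_antipode_mul_hitLeft]
        generalize (comul g : H ⊗[k] H) = t
        induction t with
        | zero => simp
        | add s t hs ht => simp only [map_add, mul_add, add_mul, hs, ht]
        | tmul a b =>
          simp only [m, hitLeftMul, TensorProduct.map_tmul, LinearMap.mul'_apply,
            LinearMap.comp_apply, LinearMap.mulRight_apply, LinearEquiv.coe_coe,
            TensorProduct.comm_tmul, HopfAlgebra.antipode_mul_antidistrib,
            ← rightMul_mul, ← mul_assoc]
          rw [hitLeft_mul]; rfl

/-- The antipode of a finite-dimensional Hopf algebra is bijective. -/
theorem antipode_bijective [FiniteDimensional k H] :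
    Function.Bijective (HopfAlgebra.antipode k (A := H)) := by
  suffices h : Function.Injective (HopfAlgebra.antipode k (A := H)) from
    ⟨h, LinearMap.injective_iff_surjective.mp h⟩
  have : Nontrivial H := ⟨1, 0, fun h => by
    simpa using congrArg (counit (R := k)) h⟩
  let e : H ⊗[k] Module.Dual k H ≃ₗ[k] Module.End k H :=
    LinearEquiv.ofBijective hitRightMul hitRightMul_bijective
  have he (t) : e t = hitRightMul t := rfl
  -- The map is defined without any inverse of `S`. Simplicity of the matrix ring `End(H)` makes it
  -- injective, and injectivity of `S` follows.
  let θ : Module.End k H →+* (Module.End k H)ᵐᵒᵖ :=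
    { toFun := fun T => .op (hitLeftMul (e.symm T))
      map_zero' := by simp
      map_add' := by simp
      map_one' := by
        have : e.symm 1 = 1 ⊗ₜ counit := by
          rw [LinearEquiv.symm_apply_eq]
          ext x
          simp [he, hitRightMul, hitRight_apply]
        rw [this, ← MulOpposite.op_one]
        congr 1
        ext x
        simp [hitLeftMul, hitLeft_apply]
      map_mul' := fun T U => by
        obtain ⟨w, h1, h2⟩ := exists_hitRightMul_mul (e.symm T) (e.symm U)
        rw [← he, ← he, ← he, e.apply_symm_apply, e.apply_symm_apply] at h1
        rw [← MulOpposite.op_mul, h2, h1, e.symm_apply_apply] }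
  have : IsSimpleRing (Module.End k H) := by
    have : Nonempty (Fin (Module.finrank k H)) := ⟨⟨0, Module.finrank_pos⟩⟩
    exact IsSimpleRing.of_ringEquiv
      (algEquivMatrix (Module.finBasis k H)).symm.toRingEquiv inferInstance
  have hθ : Function.Injective θ := θ.injective
  rw [← LinearMap.ker_eq_bot, LinearMap.ker_eq_bot']
  intro h hh
  -- If `S(h) = 0`, then `hitLeftMul` kills `h ⊗ ε`, as it involves `h` only through `S(h)`.
  have h1 : θ (e (h ⊗ₜ counit)) = 0 := by
    change MulOpposite.op (hitLeftMul (e.symm (e (h ⊗ₜ counit)))) = 0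
    rw [e.symm_apply_apply]
    simp [hitLeftMul, hh]
  have h2 := hθ (h1.trans θ.map_zero.symm)
  have h3 := e.injective (h2.trans e.map_zero.symm)
  simpa using congrArg (TensorProduct.rid k H ∘ (Module.Dual.eval k H 1).lTensor H) h3

end AntipodeBijective

/-! ### A linear criterion for convolution invertibility -/

section Spread
variable {k A C : Type u} [Field k] [Ring A] [Algebra k A] [AddCommGroup C] [Module k C]
  [Coalgebra k C]

/-- `a ⊗ c ↦ ∑ a q(c₁) ⊗ c₂` -/
def spread (q : WithConv (C →ₗ[k] A)) : A ⊗[k] C →ₗ[k] A ⊗[k] C :=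
  (LinearMap.mul' k A).rTensor C ∘ₗ (TensorProduct.assoc k A A C).symm.toLinearMap ∘ₗ
    (q.ofConv.rTensor C ∘ₗ comul).lTensor A

lemma spread_tmul (q : WithConv (C →ₗ[k] A)) (a : A) (c : C) :
    spread q (a ⊗ₜ c) = (LinearMap.mulLeft k a ∘ₗ q.ofConv).rTensor C (comul c) := by
  simp only [spread, LinearMap.comp_apply, LinearMap.lTensor_tmul]
  generalize (comul c : C ⊗[k] C) = t
  induction t with
  | zero => simp
  | add s t hs ht => simp only [map_add, tmul_add, hs, ht]
  | tmul x y => simp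

lemma spread_one_tmul (q : WithConv (C →ₗ[k] A)) (c : C) :
    spread q (1 ⊗ₜ c) = q.ofConv.rTensor C (comul c) := by
  rw [spread_tmul, LinearMap.mulLeft_one, LinearMap.id_comp]

lemma spread_one : spread (1 : WithConv (C →ₗ[k] A)) = LinearMap.id := by
  ext a c
  simp only [TensorProduct.AlgebraTensorModule.curry_apply, LinearMap.restrictScalars_self,
    TensorProduct.curry_apply, spread_tmul, LinearMap.id_apply]
  have key (t : C ⊗[k] C) : (LinearMap.mulLeft k a ∘ₗ
      (1 : WithConv (C →ₗ[k] A)).ofConv).rTensor C t =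
      a ⊗ₜ TensorProduct.lid k C (counit.rTensor C t) := by
    induction t with
    | zero => simp
    | add s t hs ht => simp only [map_add, tmul_add, hs, ht]
    | tmul x y => simp [Algebra.algebraMap_eq_smul_one, TensorProduct.smul_tmul]
  simp [key]

/-- Coassociativity: both sides send `a ⊗ c` to `∑ a p(c₁) q(c₂) ⊗ c₃`. The order is reversed
because values are multiplied onto `a` from the right. -/
lemma spread_mul (p q : WithConv (C →ₗ[k] A)) : spread (p * q) = spread q ∘ₗ spread p := by
  ext a c
  simp only [TensorProduct.AlgebraTensorModule.curry_apply, LinearMap.restrictScalars_self,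
    TensorProduct.curry_apply, LinearMap.comp_apply]
  let G : C ⊗[k] (C ⊗[k] C) →ₗ[k] A ⊗[k] C :=
    (LinearMap.mul' k A).rTensor C ∘ₗ (TensorProduct.assoc k A A C).symm.toLinearMap ∘ₗ
      TensorProduct.map (LinearMap.mulLeft k a ∘ₗ p.ofConv) (q.ofConv.rTensor C)
  have h1 (t : C ⊗[k] C) : (LinearMap.mulLeft k a ∘ₗ (p * q).ofConv).rTensor C t =
      G (TensorProduct.assoc k C C C (LinearMap.rTensor C comul t)) := by
    induction t with
    | zero => simp
    | add s t hs ht => simp only [map_add, hs, ht]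
    | tmul x y =>
      simp only [LinearMap.rTensor_tmul, LinearMap.comp_apply, LinearMap.convMul_apply]
      generalize (comul x : C ⊗[k] C) = t
      induction t with
      | zero => simp
      | add s t hs ht => simp only [map_add, add_tmul, hs, ht]
      | tmul u v => simp [G, mul_assoc]
  have h2 (t : C ⊗[k] C) : spread q ((LinearMap.mulLeft k a ∘ₗ p.ofConv).rTensor C t) =
      G (LinearMap.lTensor C comul t) := by
    induction t with
    | zero => simp
    | add s t hs ht => simp only [map_add, hs, ht]
    | tmul x y =>
      simp only [LinearMap.rTensor_tmul, LinearMap.lTensor_tmul, LinearMap.comp_apply, spread_tmul]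
      generalize (comul y : C ⊗[k] C) = t
      induction t with
      | zero => simp
      | add s t hs ht => simp only [map_add, tmul_add, hs, ht]
      | tmul u v => simp [G, mul_assoc]
  rw [spread_tmul, spread_tmul, h1, h2, coassoc_apply]

/-- Applying the counit to the second factor of `spread p (1 ⊗ c)` recovers `p(c)`. -/
lemma spread_injective : Function.Injective (spread : WithConv (C →ₗ[k] A) → _) := by
  intro p q h
  ext c
  have key (p : WithConv (C →ₗ[k] A)) :
      TensorProduct.rid k A (counit.lTensor A (spread p (1 ⊗ₜ c))) = p c := by
    have (t : C ⊗[k] C) : TensorProduct.rid k A (counit.lTensor A (p.ofConv.rTensor C t)) =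
        p (TensorProduct.rid k C (counit.lTensor C t)) := by
      induction t with
      | zero => simp
      | add s t hs ht => simp only [map_add, hs, ht]
      | tmul x y => simp
    rw [spread_one_tmul, this]
    simp
  rw [← key, ← key, h]

lemma spread_rTensor_mulLeft (q : WithConv (C →ₗ[k] A)) (a : A) (x : A ⊗[k] C) :
    spread q ((LinearMap.mulLeft k a).rTensor C x) =
      (LinearMap.mulLeft k a).rTensor C (spread q x) := by
  induction x with
  | zero => simp
  | add x y hx hy => simp only [map_add, hx, hy]
  | tmul b c =>
    rw [LinearMap.rTensor_tmul, spread_tmul, spread_tmul, ← LinearMap.rTensor_comp_apply,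
      LinearMap.mulLeft_apply, LinearMap.mulLeft_mul, LinearMap.comp_assoc]

/-- The coaction `a ⊗ c ↦ ∑ (a ⊗ c₁) ⊗ c₂`. -/
def tensorCoact : A ⊗[k] C →ₗ[k] (A ⊗[k] C) ⊗[k] C :=
  (TensorProduct.assoc k A C C).symm.toLinearMap ∘ₗ comul.lTensor A

lemma spread_rTensor_tensorCoact (q : WithConv (C →ₗ[k] A)) (x : A ⊗[k] C) :
    (spread q).rTensor C (tensorCoact x) = tensorCoact (spread q x) := by
  induction x with
  | zero => simp
  | add x y hx hy => simp only [map_add, hx, hy]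
  | tmul a c =>
    have h1 (t : C ⊗[k] C) : (spread q).rTensor C ((TensorProduct.assoc k A C C).symm (a ⊗ₜ t)) =
        (TensorProduct.assoc k A C C).symm (((LinearMap.mulLeft k a ∘ₗ q.ofConv).rTensor _
          (TensorProduct.assoc k C C C (LinearMap.rTensor C comul t)))) := by
      induction t with
      | zero => simp
      | add s t hs ht => simp only [map_add, tmul_add, hs, ht]
      | tmul x y =>
        simp only [TensorProduct.assoc_symm_tmul, LinearMap.rTensor_tmul, spread_tmul]
        generalize (comul x : C ⊗[k] C) = t
        induction t with
        | zero => simp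
        | add s t hs ht => simp only [map_add, add_tmul, hs, ht]
        | tmul u v => simp
    have h2 (t : C ⊗[k] C) : tensorCoact ((LinearMap.mulLeft k a ∘ₗ q.ofConv).rTensor C t) =
        (TensorProduct.assoc k A C C).symm (((LinearMap.mulLeft k a ∘ₗ q.ofConv).rTensor _
          (LinearMap.lTensor C comul t))) := by
      induction t with
      | zero => simp
      | add s t hs ht => simp only [map_add, hs, ht]
      | tmul x y => simp [tensorCoact]
    rw [spread_tmul, h2, ← coassoc_apply, ← h1]
    rfl

/-- The operators `spread q` are left `A`-linear and commute with the coaction on `C`. The inverse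
operator inherits both properties, and they force it to be `spread p` for its own counit component
`p`. This produces a convolution inverse without a formula. -/
lemma isUnit_of_spread_bijective {q : WithConv (C →ₗ[k] A)}
    (hq : Function.Bijective (spread q)) : IsUnit q := by
  let e : A ⊗[k] C ≃ₗ[k] A ⊗[k] C := LinearEquiv.ofBijective (spread q) hq
  have he (x) : e x = spread q x := rfl
  have he' : (e : A ⊗[k] C →ₗ[k] A ⊗[k] C) = spread q := rfl
  let ε : A ⊗[k] C →ₗ[k] A := (TensorProduct.rid k A).toLinearMap ∘ₗ counit.lTensor A
  let p : WithConv (C →ₗ[k] A) := toConv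
    (ε ∘ₗ e.symm.toLinearMap ∘ₗ TensorProduct.mk k A C 1)
  have h1 (x : A ⊗[k] C) : ε.rTensor C (tensorCoact x) = x := by
    induction x with
    | zero => simp
    | add x y hx hy => simp only [map_add, hx, hy]
    | tmul a c =>
      have (t : C ⊗[k] C) : ε.rTensor C ((TensorProduct.assoc k A C C).symm (a ⊗ₜ t)) =
          a ⊗ₜ TensorProduct.lid k C (counit.rTensor C t) := by
        induction t with
        | zero => simp
        | add s t hs ht => simp only [map_add, tmul_add, hs, ht]
        | tmul x y => simp [ε, TensorProduct.smul_tmul]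
      simp [tensorCoact, this]
  have h2 (x : A ⊗[k] C) : e.symm.toLinearMap.rTensor C (tensorCoact x) =
      tensorCoact (e.symm x) := by
    obtain ⟨y, rfl⟩ := e.surjective x
    rw [e.symm_apply_apply, he, ← spread_rTensor_tensorCoact, ← he', ← LinearMap.rTensor_comp_apply]
    simp
  -- Compatibility of `e.symm` with the coaction gives agreement on `1 ⊗ C`; left `A`-linearity
  -- extends it in `h4`.
  have h3 (c : C) : spread p (1 ⊗ₜ c) = e.symm (1 ⊗ₜ c) := by
    rw [← h1 (e.symm (1 ⊗ₜ c)), ← h2, spread_one_tmul, tensorCoact, ← LinearMap.rTensor_comp_apply]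
    simp only [LinearMap.comp_apply, LinearMap.lTensor_tmul]
    generalize (comul c : C ⊗[k] C) = t
    induction t with
    | zero => simp
    | add s t hs ht => simp only [map_add, tmul_add, hs, ht]
    | tmul x y => simp [p]
  have h4 (x : A ⊗[k] C) : spread p x = e.symm x := by
    induction x with
    | zero => simp
    | add x y hx hy => simp only [map_add, hx, hy]
    | tmul a c =>
      have h5 : a ⊗ₜ c = (LinearMap.mulLeft k a).rTensor C ((1 : A) ⊗ₜ[k] c) := by simp
      rw [h5, spread_rTensor_mulLeft, h3, LinearEquiv.eq_symm_apply, he, spread_rTensor_mulLeft,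
        ← he, e.apply_symm_apply]
  refine ⟨⟨q, p, spread_injective ?_, spread_injective ?_⟩, rfl⟩
  · rw [spread_mul, spread_one]
    apply LinearMap.ext
    intro x
    simp [h4, ← he]
  · rw [spread_mul, spread_one]
    apply LinearMap.ext
    intro x
    simp [h4, ← he]

lemma spread_bijective {q : WithConv (C →ₗ[k] A)} (hq : IsUnit q) :
    Function.Bijective (spread q) := by
  obtain ⟨u, rfl⟩ := hq
  refine Function.bijective_iff_has_inverse.mpr ⟨spread u⁻¹.val, fun x => ?_, fun x => ?_⟩
  · rw [← LinearMap.comp_apply, ← spread_mul, Units.mul_inv, spread_one, LinearMap.id_apply]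
  · rw [← LinearMap.comp_apply, ← spread_mul, Units.inv_mul, spread_one, LinearMap.id_apply]

end Spread

/-! ### Invertibility of the map `γ : H → R #_σ H` -/

namespace CrossedSystem
variable {k H R : Type u} [Field k] [Ring H] [Ring R] [Algebra k R]

section Bialgebra
variable [Bialgebra k H] (S : CrossedSystem k H R)

lemma tmul_add (r : R) (g h : H) : S.tmul r (g + h) = S.tmul r g + S.tmul r h :=
  TensorProduct.tmul_add r g h

lemma add_tmul (r s : R) (h : H) : S.tmul (r + s) h = S.tmul r h + S.tmul s h :=
  TensorProduct.add_tmul r s h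

@[elab_as_elim]
lemma induction_on {motive : S.CrossedProduct → Prop} (x : S.CrossedProduct) (zero : motive 0)
    (tmul : ∀ r h, motive (S.tmul r h)) (add : ∀ x y, motive x → motive y → motive (x + y)) :
    motive x :=
  TensorProduct.induction_on x zero tmul add

/-- The map `γ : h ↦ 1 # h`. -/
def gamma : WithConv (H →ₗ[k] S.CrossedProduct) := toConv (TensorProduct.mk k R H 1)

lemma gamma_apply (h : H) : S.gamma h = S.tmul 1 h := rfl

lemma actLeft_one : toConv (S.actLeft 1) = 1 := by
  ext h g
  simp [actLeft, S.act_one, Algebra.smul_def]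

lemma tmul_mul_gamma (r : R) (g h : H) : S.tmul r g * S.gamma h =
    TensorProduct.map (LinearMap.mulLeft k r ∘ₗ S.cocycle.val.ofConv) (LinearMap.mul' k H)
      (comul (g ⊗ₜ[k] h)) := by
  have h1 : S.mulAux 1 = (sharp S.cocycle.val (LinearMap.mul' k H)).ofConv := by
    rw [← ofConv_toConv (S.mulAux 1), mulAux_eq_sharp, actLeft_one, one_mul]
  have key (t : (H ⊗[k] H) ⊗[k] (H ⊗[k] H)) :
      (r ⊗ₜ[k] (1 : H)) * TensorProduct.map S.cocycle.val.ofConv (LinearMap.mul' k H) t =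
      TensorProduct.map (LinearMap.mulLeft k r ∘ₗ S.cocycle.val.ofConv) (LinearMap.mul' k H) t := by
    induction t with
    | zero => simp
    | add s t hs ht => simp only [map_add, mul_add, hs, ht]
    | tmul x y => simp
  rw [gamma_apply, tmul_mul_tmul, h1, sharp_apply]
  exact key _

/-- The associator `(R #_σ H) ⊗ H ≃ R ⊗ (H ⊗ H)`. -/
def assocEquiv : S.CrossedProduct ⊗[k] H ≃ₗ[k] R ⊗[k] (H ⊗[k] H) :=
  TensorProduct.assoc k R H H

/-- Both sides send `(r # g) ⊗ h` to `∑ r σ(g₁, h₁) ⊗ g₂ h₂ ⊗ h₃`. Thus `spread γ` factors into the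
operators of `σ` and of the identity of `H`, each known to be invertible. -/
lemma assocEquiv_spread_gamma (x : S.CrossedProduct ⊗[k] H) :
    S.assocEquiv (spread S.gamma x) =
      (spread (toConv LinearMap.id : WithConv (H →ₗ[k] H))).lTensor R
        (spread S.cocycle.val (S.assocEquiv x)) := by
  induction x with
  | zero => simp
  | add x y hx hy => simp only [map_add, hx, hy]
  | tmul a h =>
  induction a using S.induction_on with
  | zero => simp only [TensorProduct.zero_tmul, map_zero]
  | add x y hx hy => simp only [TensorProduct.add_tmul, map_add, hx, hy]
  | tmul r g =>
  -- For `u = u₁ ⊗ u₂`, `F u` sends `x ⊗ (y ⊗ z)` to `r σ(u₁, x) ⊗ (u₂ y ⊗ z)`. Each side is `F (Δ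
  -- g)` at one of the two bracketings of the iterated coproduct of `h`.
  let F (u : H ⊗[k] H) : H ⊗[k] (H ⊗[k] H) →ₗ[k] R ⊗[k] (H ⊗[k] H) :=
    TensorProduct.map (LinearMap.mulLeft k r ∘ₗ S.cocycle.val.ofConv)
      ((LinearMap.mul' k H).rTensor H ∘ₗ (TensorProduct.assoc k H H H).symm.toLinearMap) ∘ₗ
    (TensorProduct.tensorTensorTensorComm k H H H (H ⊗[k] H)).toLinearMap ∘ₗ
      TensorProduct.mk k (H ⊗[k] H) (H ⊗[k] (H ⊗[k] H)) u
  have h1 (t : H ⊗[k] H) : S.assocEquiv ((LinearMap.mulLeft k (S.tmul r g) ∘ₗ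
        S.gamma.ofConv).rTensor H t) =
      F (comul g) (TensorProduct.assoc k H H H (LinearMap.rTensor H comul t)) := by
    induction t with
    | zero => simp
    | add s t hs ht => simp only [map_add, hs, ht]
    | tmul x y =>
      simp only [LinearMap.rTensor_tmul, LinearMap.comp_apply, LinearMap.mulLeft_apply,
        tmul_mul_gamma, TensorProduct.comul_tmul]
      generalize (comul g : H ⊗[k] H) = u
      generalize (comul x : H ⊗[k] H) = v
      change TensorProduct.assoc k R H H (_ ⊗ₜ[k] y) = _
      induction u with
      | zero => simp [F]
      | add s t hs ht =>
        simp only [F, LinearMap.comp_apply, map_add, TensorProduct.add_tmul, LinearMap.add_apply] at hs ht ⊢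
        rw [hs, ht]
      | tmul u u' =>
        induction v with
        | zero => simp
        | add s t hs ht => simp only [map_add, TensorProduct.tmul_add, TensorProduct.add_tmul, hs, ht]
        | tmul v v' => simp [F]
  have h2 (t : H ⊗[k] H) : (spread (toConv LinearMap.id : WithConv (H →ₗ[k] H))).lTensor R
        ((LinearMap.mulLeft k r ∘ₗ S.cocycle.val.ofConv).rTensor (H ⊗[k] H)
          (TensorProduct.AlgebraTensorModule.tensorTensorTensorComm k k k k H H H H
            (comul g ⊗ₜ t))) =
      F (comul g) (LinearMap.lTensor H comul t) := by
    induction t with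
    | zero => simp
    | add s t hs ht => simp only [map_add, TensorProduct.tmul_add, hs, ht]
    | tmul x y =>
      generalize (comul g : H ⊗[k] H) = u
      induction u with
      | zero => simp [F]
      | add s t hs ht =>
        simp only [F, LinearMap.comp_apply, map_add, TensorProduct.add_tmul, LinearMap.add_apply] at hs ht ⊢
        rw [hs, ht]
      | tmul u u' =>
        simp only [TensorProduct.AlgebraTensorModule.tensorTensorTensorComm_tmul,
          LinearMap.rTensor_tmul, LinearMap.lTensor_tmul, spread_tmul]
        generalize (comul y : H ⊗[k] H) = v
        induction v with
        | zero => simp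
        | add s t hs ht => simp only [map_add, TensorProduct.tmul_add, hs, ht]
        | tmul v v' => simp [F]
  have e : S.assocEquiv (S.tmul r g ⊗ₜ[k] h) = r ⊗ₜ (g ⊗ₜ h) := rfl
  rw [e, spread_tmul, h1, spread_tmul, TensorProduct.comul_tmul, h2, coassoc_apply]

end Bialgebra

/-- The map `γ : h ↦ 1 # h` is convolution-invertible. -/
theorem isUnit_gamma [HopfAlgebra k H] (S : CrossedSystem k H R) : IsUnit S.gamma := by
  apply isUnit_of_spread_bijective
  have h : ⇑(spread S.gamma) = S.assocEquiv.symm ∘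
      (spread (toConv LinearMap.id : WithConv (H →ₗ[k] H))).lTensor R ∘
        spread S.cocycle.val ∘ S.assocEquiv := by
    funext x
    simp [← assocEquiv_spread_gamma]
  -- The antipode enters only here, as the convolution inverse of the identity.
  let e := LinearEquiv.ofBijective (spread (toConv LinearMap.id : WithConv (H →ₗ[k] H)))
    (spread_bijective ⟨⟨_, toConv (HopfAlgebra.antipode k), LinearMap.id_mul_antipode,
      LinearMap.antipode_mul_id⟩, rfl⟩)
  rw [h]
  exact S.assocEquiv.symm.bijective.comp ((e.lTensor R).bijective.comp
    ((spread_bijective S.cocycle.isUnit).comp S.assocEquiv.bijective))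

end CrossedSystem

/-! ### The inverse antipode as a convolution inverse in the opposite algebra -/

section AntipodeInv
variable {k K : Type u} [Field k] [Ring K] [HopfAlgebra k K] [FiniteDimensional k K]

/-- The inverse of the antipode of a finite-dimensional Hopf algebra. -/
def antipodeInv : K ≃ₗ[k] K := (LinearEquiv.ofBijective _ antipode_bijective).symm

@[simp] lemma antipode_antipodeInv (x : K) :
    HopfAlgebra.antipode k (antipodeInv (k := k) x) = x :=
  LinearEquiv.apply_symm_apply (LinearEquiv.ofBijective _ antipode_bijective) x

lemma antipodeInv_mul (x y : K) :
    antipodeInv (k := k) (x * y) = antipodeInv (k := k) y * antipodeInv (k := k) x := by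
  apply (antipode_bijective (k := k) (H := K)).injective
  simp [HopfAlgebra.antipode_mul_antidistrib]

lemma antipodeInv_one : antipodeInv (k := k) (1 : K) = 1 := by
  apply (antipode_bijective (k := k) (H := K)).injective
  simp

/-- Read in `K`, this is `∑ S⁻¹(x₂) x₁ = ε(x)`; applying `S` turns it into the antipode axiom `∑
S(x₁) x₂ = ε(x)`. -/
lemma op_mul_op_antipodeInv :
    (toConv (MulOpposite.opLinearEquiv k).toLinearMap *
      toConv ((MulOpposite.opLinearEquiv k).toLinearMap ∘ₗ antipodeInv.toLinearMap) :
        WithConv (K →ₗ[k] Kᵐᵒᵖ)) = 1 := by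
  ext x
  apply MulOpposite.unop_injective
  apply (antipode_bijective (k := k) (H := K)).injective
  have key (t : K ⊗[k] K) : HopfAlgebra.antipode k (MulOpposite.unop (LinearMap.mul' k Kᵐᵒᵖ
      (TensorProduct.map (MulOpposite.opLinearEquiv k).toLinearMap
        ((MulOpposite.opLinearEquiv k).toLinearMap ∘ₗ antipodeInv.toLinearMap) t))) =
      LinearMap.mul' k K ((HopfAlgebra.antipode k).rTensor K t) := by
    induction t with
    | zero => simp
    | add s t hs ht => simp only [map_add, MulOpposite.unop_add, hs, ht]
    | tmul a b => simp [HopfAlgebra.antipode_mul_antidistrib]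
  rw [LinearMap.convMul_apply, key]
  simp [Algebra.algebraMap_eq_smul_one]

lemma op_antipodeInv_mul_op :
    (toConv ((MulOpposite.opLinearEquiv k).toLinearMap ∘ₗ antipodeInv.toLinearMap) *
      toConv (MulOpposite.opLinearEquiv k).toLinearMap :
        WithConv (K →ₗ[k] Kᵐᵒᵖ)) = 1 := by
  ext x
  apply MulOpposite.unop_injective
  apply (antipode_bijective (k := k) (H := K)).injective
  have key (t : K ⊗[k] K) : HopfAlgebra.antipode k (MulOpposite.unop (LinearMap.mul' k Kᵐᵒᵖ
      (TensorProduct.map ((MulOpposite.opLinearEquiv k).toLinearMap ∘ₗ antipodeInv.toLinearMap)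
        (MulOpposite.opLinearEquiv k).toLinearMap t))) =
      LinearMap.mul' k K ((HopfAlgebra.antipode k).lTensor K t) := by
    induction t with
    | zero => simp
    | add s t hs ht => simp only [map_add, MulOpposite.unop_add, hs, ht]
    | tmul a b => simp [HopfAlgebra.antipode_mul_antidistrib]
  rw [LinearMap.convMul_apply, key]
  simp [Algebra.algebraMap_eq_smul_one]

end AntipodeInv

/-! ### Convolution calculus for module algebras -/

section Const
variable {k A C : Type u} [Field k] [Ring A] [Algebra k A] [AddCommGroup C] [Module k C]
  [Coalgebra k C]

lemma const_mul_apply (b : A) (q : WithConv (C →ₗ[k] A)) (c : C) :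
    (CrossedSystem.const b * q : WithConv (C →ₗ[k] A)) c = b * q c := by
  have key (t : C ⊗[k] C) : LinearMap.mul' k A (TensorProduct.map
      (CrossedSystem.const b : WithConv (C →ₗ[k] A)).ofConv q.ofConv t) =
      b * q (TensorProduct.lid k C (counit.rTensor C t)) := by
    induction t with
    | zero => simp
    | add s t hs ht => simp only [map_add, mul_add, hs, ht]
    | tmul x y => simp [CrossedSystem.const]
  rw [LinearMap.convMul_apply, key]
  simp

lemma mul_const_apply (b : A) (q : WithConv (C →ₗ[k] A)) (c : C) :
    (q * CrossedSystem.const b : WithConv (C →ₗ[k] A)) c = q c * b := by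
  have key (t : C ⊗[k] C) : LinearMap.mul' k A (TensorProduct.map q.ofConv
      (CrossedSystem.const b : WithConv (C →ₗ[k] A)).ofConv t) =
      q (TensorProduct.rid k C (counit.lTensor C t)) * b := by
    induction t with
    | zero => simp
    | add s t hs ht => simp only [map_add, add_mul, hs, ht]
    | tmul x y => simp [CrossedSystem.const]
  rw [LinearMap.convMul_apply, key]
  simp

end Const

section ModuleAlgebra
variable {k K A : Type u} [Field k] [Ring K] [HopfAlgebra k K] [Ring A] [Algebra k A]

/-- `a ⊗ g ↦ ∑ p(g₂) a ⊗ g₁` -/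
def twist (p : WithConv (K →ₗ[k] Module.End k A)) : A ⊗[k] K →ₗ[k] A ⊗[k] K :=
  TensorProduct.lift ((LinearMap.rTensorHom K ∘ₗ p.ofConv.flip).compl₂
    ((TensorProduct.comm k K K).toLinearMap ∘ₗ comul))

lemma twist_tmul (p : WithConv (K →ₗ[k] Module.End k A)) (a : A) (g : K) :
    twist p (a ⊗ₜ g) = (p.ofConv.flip a).rTensor K (TensorProduct.comm k K K (comul g)) := rfl

lemma twist_one : twist (1 : WithConv (K →ₗ[k] Module.End k A)) = LinearMap.id := by
  ext a g
  simp only [TensorProduct.AlgebraTensorModule.curry_apply, LinearMap.restrictScalars_self,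
    TensorProduct.curry_apply, twist_tmul, LinearMap.id_apply]
  have key (t : K ⊗[k] K) : ((1 : WithConv (K →ₗ[k] Module.End k A)).ofConv.flip a).rTensor K
      (TensorProduct.comm k K K t) = a ⊗ₜ TensorProduct.rid k K (counit.lTensor K t) := by
    induction t with
    | zero => simp
    | add s t hs ht => simp only [map_add, tmul_add, hs, ht]
    | tmul x y =>
      simp [Algebra.algebraMap_eq_smul_one, TensorProduct.smul_tmul]
  simp [key]

/-- Both sides give `∑ p(g₂) q(g₃) a ⊗ g₁`. The order is kept, so a convolution inverse of `p`
yields an inverse of `twist p`. -/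
lemma twist_mul (p q : WithConv (K →ₗ[k] Module.End k A)) :
    twist (p * q) = twist p ∘ₗ twist q := by
  ext a g
  simp only [TensorProduct.AlgebraTensorModule.curry_apply, LinearMap.restrictScalars_self,
    TensorProduct.curry_apply, LinearMap.comp_apply]
  let G : K ⊗[k] (K ⊗[k] K) →ₗ[k] A ⊗[k] K :=
    (TensorProduct.lift (p.ofConv.flip.flip.compl₂ (q.ofConv.flip a))).rTensor K ∘ₗ
      (TensorProduct.comm k K (K ⊗[k] K)).toLinearMap
  have h1 (t : K ⊗[k] K) : ((p * q).ofConv.flip a).rTensor K (TensorProduct.comm k K K t) =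
      G (LinearMap.lTensor K comul t) := by
    induction t with
    | zero => simp
    | add s t hs ht => simp only [map_add, hs, ht]
    | tmul x y =>
      simp only [LinearMap.rTensor_tmul, LinearMap.flip_apply, LinearMap.convMul_apply,
        LinearMap.lTensor_tmul, TensorProduct.comm_tmul]
      generalize (comul y : K ⊗[k] K) = t
      induction t with
      | zero => simp
      | add s t hs ht => simp only [map_add, tmul_add, add_tmul, LinearMap.add_apply, hs, ht]
      | tmul u v => simp [G]
  have h2 (t : K ⊗[k] K) : twist p ((q.ofConv.flip a).rTensor K (TensorProduct.comm k K K t)) =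
      G (TensorProduct.assoc k K K K (LinearMap.rTensor K comul t)) := by
    induction t with
    | zero => simp
    | add s t hs ht => simp only [map_add, hs, ht]
    | tmul x y =>
      simp only [LinearMap.rTensor_tmul, twist_tmul, TensorProduct.comm_tmul]
      generalize (comul x : K ⊗[k] K) = t
      induction t with
      | zero => simp
      | add s t hs ht => simp only [map_add, add_tmul, hs, ht]
      | tmul u v => simp [G]
  rw [twist_tmul, twist_tmul, h1, h2, coassoc_apply]

lemma toConv_algHom_comp_one {E F : Type u} [Ring E] [Ring F] [Algebra k E] [Algebra k F]
    (φ : E →ₐ[k] F) :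
    toConv (φ.toLinearMap ∘ₗ (1 : WithConv (K →ₗ[k] E)).ofConv) = 1 := by
  ext x; simp

variable (α : K →ₐ[k] Module.End k A)

/-- The convolution inverse of a representation `α` is `α ∘ S`. -/
lemma twist_bijective : Function.Bijective (twist (toConv α.toLinearMap)) := by
  have h1 : toConv α.toLinearMap * toConv (α.toLinearMap ∘ₗ HopfAlgebra.antipode k) = 1 := by
    rw [← toConv_algHom_comp_one α, ← LinearMap.id_mul_antipode,
      LinearMap.algHom_comp_convMul_distrib]
    rfl
  have h2 : toConv (α.toLinearMap ∘ₗ HopfAlgebra.antipode k) * toConv α.toLinearMap = 1 := by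
    rw [← toConv_algHom_comp_one α, ← LinearMap.antipode_mul_id,
      LinearMap.algHom_comp_convMul_distrib]
    rfl
  refine Function.bijective_iff_has_inverse.mpr
    ⟨twist (toConv (α.toLinearMap ∘ₗ HopfAlgebra.antipode k)), fun x => ?_, fun x => ?_⟩
  · rw [← LinearMap.comp_apply, ← twist_mul, h2, twist_one, LinearMap.id_apply]
  · rw [← LinearMap.comp_apply, ← twist_mul, h1, twist_one, LinearMap.id_apply]

/-- `f ↦ op (f ⇀ ·)` -/
def opAct : WithConv (K →ₗ[k] (Module.End k A)ᵐᵒᵖ) :=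
  toConv ((MulOpposite.opLinearEquiv k).toLinearMap ∘ₗ α.toLinearMap)

/-- The algebra homomorphism `a ↦ op (· a)`. -/
def opMulRight : A →ₐ[k] (Module.End k A)ᵐᵒᵖ := AlgHom.ofLinearMap
  ((MulOpposite.opLinearEquiv k).toLinearMap ∘ₗ (LinearMap.mul k A).flip)
  (by apply MulOpposite.unop_injective; ext; simp)
  (by intro a b; apply MulOpposite.unop_injective; ext; simp [mul_assoc])

lemma opMulRight_apply (a : A) : opMulRight (k := k) a = .op (LinearMap.mulRight k a) := rfl

-- The rule `f(x b) = ∑ (f₁ x)(f₂ b)`, viewed as an identity of operators in `x`. Passing to the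
-- opposite of `End(A)` puts the factors in the order in which `f₁` and `f₂` occur, so that it
-- becomes a convolution identity.
variable {α} in
lemma const_mul_opAct (hα : ∀ f x y, α f (x * y) = LinearMap.mul' k A
    (TensorProduct.map (α.toLinearMap.flip x) (α.toLinearMap.flip y) (comul f))) (b : A) :
    CrossedSystem.const (opMulRight (k := k) b) * opAct α =
    opAct α * toConv ((opMulRight (k := k)).toLinearMap ∘ₗ α.toLinearMap.flip b) := by
  ext f
  rw [const_mul_apply]
  apply MulOpposite.unop_injective
  ext x
  have key (t : K ⊗[k] K) : LinearMap.mul' k A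
      (TensorProduct.map (α.toLinearMap.flip x) (α.toLinearMap.flip b) t) =
      MulOpposite.unop (LinearMap.mul' k (Module.End k A)ᵐᵒᵖ (TensorProduct.map (opAct α).ofConv
        ((opMulRight (k := k)).toLinearMap ∘ₗ α.toLinearMap.flip b) t)) x := by
    induction t with
    | zero => simp
    | add s t hs ht => simp only [map_add, MulOpposite.unop_add, LinearMap.add_apply, hs, ht]
    | tmul g h => simp [opAct, opMulRight_apply]
  refine Eq.trans ?_ (key (comul f))
  rw [← hα]
  rfl

variable [FiniteDimensional k K]

/-- `f ↦ op (S⁻¹(f) ⇀ ·)` -/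
def opActInv : WithConv (K →ₗ[k] (Module.End k A)ᵐᵒᵖ) :=
  toConv ((MulOpposite.opLinearEquiv k).toLinearMap ∘ₗ α.toLinearMap ∘ₗ antipodeInv.toLinearMap)

lemma opActInv_apply (f : K) : opActInv α f = .op (α (antipodeInv (k := k) f)) := rfl

lemma opActInv_map_mul (f g : K) : opActInv α (f * g) = opActInv α f * opActInv α g := by
  rw [opActInv_apply, antipodeInv_mul, map_mul, MulOpposite.op_mul]; rfl

lemma opAct_mul_opActInv : opAct α * opActInv α = 1 := by
  rw [← toConv_algHom_comp_one (AlgHom.op α), ← op_mul_op_antipodeInv,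
    LinearMap.algHom_comp_convMul_distrib]
  rfl

lemma opActInv_mul_opAct : opActInv α * opAct α = 1 := by
  rw [← toConv_algHom_comp_one (AlgHom.op α), ← op_antipodeInv_mul_op,
    LinearMap.algHom_comp_convMul_distrib]
  rfl

variable {α}
variable (hα : ∀ f x y, α f (x * y) = LinearMap.mul' k A
  (TensorProduct.map (α.toLinearMap.flip x) (α.toLinearMap.flip y) (comul f)))
include hα

/-- Solving the preceding rule for multiplication by `f b` gives `x (f b) = ∑ f₂ ((S⁻¹(f₁) x) b)`.
The inverse antipode is needed since `b` stands on the right. -/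
lemma opMulRight_act (b : A) : toConv ((opMulRight (k := k)).toLinearMap ∘ₗ α.toLinearMap.flip b) =
    opActInv α * CrossedSystem.const (opMulRight (k := k) b) * opAct α := by
  rw [mul_assoc, const_mul_opAct hα, ← mul_assoc, opActInv_mul_opAct, one_mul]

lemma opActInv_mul_const (b : A) : opActInv α * CrossedSystem.const (opMulRight (k := k) b) =
    toConv ((opMulRight (k := k)).toLinearMap ∘ₗ α.toLinearMap.flip b) * opActInv α := by
  rw [opMulRight_act hα, mul_assoc, mul_assoc, opAct_mul_opActInv, mul_one]

/-- In `y (f b) = ∑ f₂ ((S⁻¹(f₁) y) b)` the inner element stays in `Y`, its product with `b` is in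
`N`, and `N` is stable. So the condition `Y b ⊆ N` passes from `b` to `f b`. -/
lemma mul_act_mem {Y N : Submodule k A} (hY : ∀ f, ∀ y ∈ Y, α f y ∈ Y)
    (hN : ∀ f, ∀ y ∈ N, α f y ∈ N) {b : A} (hb : ∀ y ∈ Y, y * b ∈ N) (f : K) {y : A}
    (hy : y ∈ Y) : y * α f b ∈ N := by
  have h := congrArg (fun z : WithConv (K →ₗ[k] (Module.End k A)ᵐᵒᵖ) =>
    MulOpposite.unop (z f) y) (opMulRight_act hα b)
  have h' : y * α f b = MulOpposite.unop ((opActInv α *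
    CrossedSystem.const (opMulRight (k := k) b) * opAct α :
      WithConv (K →ₗ[k] (Module.End k A)ᵐᵒᵖ)) f) y := h
  rw [h', LinearMap.convMul_apply]
  generalize (comul f : K ⊗[k] K) = t
  induction t with
  | zero => simp
  | add s t hs ht =>
    simp only [map_add, MulOpposite.unop_add, LinearMap.add_apply]
    exact N.add_mem hs ht
  | tmul g h =>
    rw [TensorProduct.map_tmul, mul_const_apply, LinearMap.mul'_apply]
    exact hN _ _ (hb _ (hY _ _ hy))

end ModuleAlgebra

instance {k H : Type u} [Field k] [Ring H] [Bialgebra k H] [FiniteDimensional k H] :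
    FiniteDimensional k (DualHopf k H) :=
  Module.Finite.equiv (DualHopf.toDual k H).symm

/-! ### Coordinates in the crossed product, and left multiplication by `γ(h)` -/

namespace CrossedSystem

section Coordinates
variable {k H R : Type u} [Field k] [Ring H] [Ring R] [Algebra k R] [Bialgebra k H]
  (S : CrossedSystem k H R)

/-- `r # h ↦ r f(h)` -/
def slice (f : H →ₗ[k] k) : S.CrossedProduct →ₗ[k] R :=
  (TensorProduct.rid k R).toLinearMap ∘ₗ f.lTensor R

@[simp] lemma slice_tmul (f : H →ₗ[k] k) (r : R) (h : H) :
    S.slice f (S.tmul r h) = f h • r := by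
  change TensorProduct.rid k R (r ⊗ₜ f h) = _
  simp

lemma smul_tmul (c : k) (r : R) (h : H) : c • S.tmul r h = S.tmul (c • r) h :=
  TensorProduct.smul_tmul' c r h

lemma tmul_smul (c : k) (r : R) (h : H) : S.tmul r (c • h) = S.tmul (c • r) h :=
  (TensorProduct.smul_tmul c r h).symm

lemma zero_tmul (h : H) : S.tmul 0 h = 0 := TensorProduct.zero_tmul _ _

lemma tmul_one_mul_tmul (r s : R) (h : H) : S.tmul r 1 * S.tmul s h = S.tmul (r * s) h := by
  have h1 := S.mulLin_left r 1 (s ⊗ₜ h)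
  rw [mul_one, one_mulLin, Algebra.TensorProduct.tmul_mul_tmul, one_mul] at h1
  exact h1

lemma tmul_one_mul_gamma (r : R) (h : H) : S.tmul r 1 * S.gamma h = S.tmul r h := by
  rw [gamma_apply, tmul_one_mul_tmul, mul_one]

lemma slice_tmul_one_mul (f : H →ₗ[k] k) (r : R) (x : S.CrossedProduct) :
    S.slice f (S.tmul r 1 * x) = r * S.slice f x := by
  induction x using S.induction_on with
  | zero => simp
  | add x y hx hy => simp only [mul_add, map_add, hx, hy]
  | tmul s h => rw [tmul_one_mul_tmul, slice_tmul, slice_tmul, mul_smul_comm]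

variable {ι : Type*} [Fintype ι] (e : Module.Basis ι k H)

lemma sum_slice_coord (x : S.CrossedProduct) : ∑ i, S.tmul (S.slice (e.coord i) x) (e i) = x := by
  induction x using S.induction_on with
  | zero => simp [zero_tmul]
  | add x y hx hy => simp only [map_add, add_tmul, Finset.sum_add_distrib, hx, hy]
  | tmul r h =>
    simp only [slice_tmul, ← tmul_smul]
    exact (TensorProduct.tmul_sum r Finset.univ fun i => e.coord i h • e i).symm.trans
      (congrArg (S.tmul r) (by simp))

lemma slice_mem_of_mem_smash {I : TwoSidedIdeal R} (f : H →ₗ[k] k) {x : S.CrossedProduct}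
    (hx : x ∈ S.smash I) : S.slice f x ∈ I := by
  refine Submodule.span_induction (p := fun x _ => S.slice f x ∈ I) ?_ ?_ ?_ ?_ hx
  · rintro _ ⟨r, hr, h, rfl⟩
    rw [slice_tmul, Algebra.smul_def]
    exact I.mul_mem_left _ _ hr
  · rw [map_zero]; exact I.zero_mem
  · intro x y _ _ hx hy; rw [map_add]; exact I.add_mem hx hy
  · intro c x _ hx; rw [map_smul, Algebra.smul_def]; exact I.mul_mem_left _ _ hx

lemma tmul_mem_smash {I : TwoSidedIdeal R} {r : R} (hr : r ∈ I) (h : H) :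
    S.tmul r h ∈ S.smash I :=
  Submodule.subset_span ⟨r, hr, h, rfl⟩

lemma mem_smash_iff {I : TwoSidedIdeal R} {x : S.CrossedProduct} :
    x ∈ S.smash I ↔ ∀ i, S.slice (e.coord i) x ∈ I := by
  refine ⟨fun h i => S.slice_mem_of_mem_smash _ h, fun h => ?_⟩
  rw [← S.sum_slice_coord e x]
  exact Submodule.sum_mem _ fun i _ => S.tmul_mem_smash (h i) _

lemma tmul_one_mul_mem_smash {I : TwoSidedIdeal R} {r : R} (hr : r ∈ I) (x : S.CrossedProduct) :
    S.tmul r 1 * x ∈ S.smash I := by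
  induction x using S.induction_on with
  | zero => simp
  | add x y hx hy => rw [mul_add]; exact add_mem hx hy
  | tmul s h => rw [tmul_one_mul_tmul]; exact S.tmul_mem_smash (I.mul_mem_right _ _ hr) _

/-- Right multiplication never acts on the coefficient in `I`, so no stability under `H` is
required; left multiplication by `γ(h)` does act on it. -/
lemma smash_mul_mem {I : TwoSidedIdeal R} {x : S.CrossedProduct} (hx : x ∈ S.smash I)
    (y : S.CrossedProduct) : x * y ∈ S.smash I := by
  refine Submodule.span_induction (p := fun x _ => x * y ∈ S.smash I) ?_ ?_ ?_ ?_ hx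
  · rintro _ ⟨r, hr, h, rfl⟩
    rw [← tmul_one_mul_gamma, mul_assoc]
    exact S.tmul_one_mul_mem_smash hr _
  · simp
  · intro x x' _ _ hx hx'; rw [add_mul]; exact add_mem hx hx'
  · intro c x _ hx; rw [smul_mul_assoc]; exact Submodule.smul_mem _ c hx

lemma sharp_cocycle_tmul_one (h : H) :
    (sharp S.cocycle.val (LinearMap.mul' k H)) (h ⊗ₜ 1) = (1 : R) ⊗ₜ h := by
  have h1 := S.mulLin_one (1 ⊗ₜ h)
  rwa [Algebra.TensorProduct.one_def, mulLin_one_tmul, actLeft_one, one_mul] at h1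

/-- `(1 # h)(r # 1) = ∑ (h₁ · r) # h₂` -/
lemma gamma_mul_tmul_one (h : H) (r : R) :
    S.gamma h * S.tmul r 1 = (S.act.flip r).rTensor H (comul h) := by
  have key (t : H ⊗[k] H) : LinearMap.mul' k (R ⊗[k] H) (TensorProduct.map
      (inl.toLinearMap ∘ₗ S.actLeft r) (sharp S.cocycle.val (LinearMap.mul' k H)).ofConv
        (TensorProduct.AlgebraTensorModule.tensorTensorTensorComm k k k k H H H H
          (t ⊗ₜ (1 ⊗ₜ 1)))) = (S.act.flip r).rTensor H t := by
    induction t with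
    | zero => simp
    | add s t hs ht => simp only [map_add, TensorProduct.add_tmul, hs, ht]
    | tmul x y =>
      rw [TensorProduct.AlgebraTensorModule.tensorTensorTensorComm_tmul, TensorProduct.map_tmul,
        sharp_cocycle_tmul_one]
      simp [actLeft]
  refine (S.mulLin_one_tmul r h 1).trans ?_
  rw [sharp_mul, LinearMap.convMul_apply, TensorProduct.comul_tmul, Bialgebra.comul_one,
    Algebra.TensorProduct.one_def]
  exact key _

lemma slice_counit_gamma_mul_tmul_one (h : H) (r : R) :
    S.slice counit (S.gamma h * S.tmul r 1) = S.act h r := by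
  have key (t : H ⊗[k] H) :
      TensorProduct.rid k R (counit.lTensor R ((S.act.flip r).rTensor H t)) =
      S.act (TensorProduct.rid k H (counit.lTensor H t)) r := by
    induction t with
    | zero => simp
    | add s t hs ht => simp only [map_add, LinearMap.add_apply, hs, ht]
    | tmul x y => simp
  rw [gamma_mul_tmul_one]
  exact (key _).trans (by simp)

lemma mem_colon {I : TwoSidedIdeal R} {r : R} : r ∈ S.colon I ↔ ∀ h, S.act h r ∈ I := by
  simp [colon, TwoSidedIdeal.mem_mk']

/-- From `γ(h)(r # 1) = ∑ (h₁ · r) # h₂`, whose counit slice is `h · r`. -/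
lemma gamma_mul_tmul_one_mem_smash {I : TwoSidedIdeal R} {r : R} :
    (∀ h, S.gamma h * S.tmul r 1 ∈ S.smash I) ↔ r ∈ S.colon I := by
  rw [mem_colon]
  refine ⟨fun hr h => ?_, fun hr h => ?_⟩
  · rw [← slice_counit_gamma_mul_tmul_one]
    exact S.slice_mem_of_mem_smash _ (hr h)
  · rw [gamma_mul_tmul_one]
    generalize (comul h : H ⊗[k] H) = t
    induction t with
    | zero => rw [map_zero]; exact zero_mem _
    | add s t hs ht => rw [map_add]; exact add_mem hs ht
    | tmul x y => exact S.tmul_mem_smash (hr x) y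

end Coordinates

section DualAction
variable {k H R : Type u} [Field k] [Ring H] [Ring R] [Algebra k R] [HopfAlgebra k H]
  [FiniteDimensional k H] (S : CrossedSystem k H R)

/-- The action of `H*` on `R #_σ H` as an algebra homomorphism. -/
def dualActHom : DualHopf k H →ₐ[k] Module.End k S.CrossedProduct :=
  AlgHom.ofLinearMap S.dualAct (LinearMap.ext dualActAux_one_apply)
    (fun f g => LinearMap.ext (dualActAux_mul_left f g))

lemma dualActHom_mul (f : DualHopf k H) (x y : S.CrossedProduct) :
    S.dualActHom f (x * y) = LinearMap.mul' k S.CrossedProduct (TensorProduct.map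
      (S.dualActHom.toLinearMap.flip x) (S.dualActHom.toLinearMap.flip y) (comul f)) :=
  S.dualAct_mul f x y

lemma dualActHom_tmul (f : DualHopf k H) (r : R) (h : H) : S.dualActHom f (S.tmul r h) =
    S.tmul r (TensorProduct.rid k H ((DualHopf.toDual k H f).lTensor H (comul h))) := rfl

lemma dualActHom_gamma (f : DualHopf k H) (h : H) : S.dualActHom f (S.gamma h) =
    S.gamma (TensorProduct.rid k H ((DualHopf.toDual k H f).lTensor H (comul h))) := rfl

lemma dualActHom_tmul_one_mul (f : DualHopf k H) (r : R) (x : S.CrossedProduct) :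
    S.dualActHom f (S.tmul r 1 * x) = S.tmul r 1 * S.dualActHom f x := by
  induction x using S.induction_on with
  | zero => simp
  | add x y hx hy => simp only [mul_add, map_add, hx, hy]
  | tmul s h => simp only [tmul_one_mul_tmul, dualActHom_tmul]

/-- Every coordinate of `x` is thereby the counit slice of a translate of `x` under `H*`, so it
suffices to control counit slices. -/
lemma slice_counit_dualActHom (f : DualHopf k H) (x : S.CrossedProduct) :
    S.slice counit (S.dualActHom f x) = S.slice (DualHopf.toDual k H f) x := by
  induction x using S.induction_on with
  | zero => simp
  | add x y hx hy => simp only [map_add, hx, hy]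
  | tmul r h =>
    have key (t : H ⊗[k] H) : counit (R := k) (TensorProduct.rid k H
        ((DualHopf.toDual k H f).lTensor H t)) =
        DualHopf.toDual k H f (TensorProduct.lid k H (counit.rTensor H t)) := by
      induction t with
      | zero => simp only [map_zero]
      | add s t hs ht => simp only [map_add, hs, ht]
      | tmul x y => simp [mul_comm]
    rw [dualActHom_tmul, slice_tmul, slice_tmul, key]
    simp

lemma dualActHom_mem_smash {I : TwoSidedIdeal R} (f : DualHopf k H) {x : S.CrossedProduct}
    (hx : x ∈ S.smash I) : S.dualActHom f x ∈ S.smash I := by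
  refine Submodule.span_induction (p := fun x _ => S.dualActHom f x ∈ S.smash I) ?_ ?_ ?_ ?_ hx
  · rintro _ ⟨r, hr, h, rfl⟩
    exact S.tmul_mem_smash hr _
  · simp
  · intro x y _ _ hx hy; rw [map_add]; exact add_mem hx hy
  · intro c x _ hx; rw [map_smul]; exact Submodule.smul_mem _ c hx

variable {ι : Type*} [Fintype ι] (e : Module.Basis ι k H)

/-- `∑ a₀ γ⁻¹(a₁)` is the image of `a` under `id # ε`. -/
lemma sum_dualActHom_mul_gamma_inv (x : S.CrossedProduct) :
    ∑ i, S.dualActHom ((DualHopf.toDual k H).symm (e.coord i)) x * S.isUnit_gamma.unit⁻¹.val (e i) =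
      S.tmul (S.slice counit x) 1 := by
  induction x using S.induction_on with
  | zero => simp [zero_tmul]
  | add x y hx hy => simp only [map_add, add_tmul, add_mul, Finset.sum_add_distrib, hx, hy]
  | tmul r h =>
    have h1 : S.gamma * S.isUnit_gamma.unit⁻¹.val = 1 := S.isUnit_gamma.mul_val_inv
    have h2 := congrArg (fun z : WithConv (H →ₗ[k] S.CrossedProduct) => S.tmul r 1 * z h) h1
    -- Summing over dual bases reassembles the second tensor factor, leaving `∑ γ(h₁) γ⁻¹(h₂) =
    -- ε(h)`.
    have key (t : H ⊗[k] H) : ∑ i, S.gamma (TensorProduct.rid k H ((e.coord i).lTensor H t)) *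
        S.isUnit_gamma.unit⁻¹.val (e i) = LinearMap.mul' k S.CrossedProduct
          (TensorProduct.map S.gamma.ofConv S.isUnit_gamma.unit⁻¹.val.ofConv t) := by
      induction t with
      | zero => simp
      | add s t hs ht => simp only [map_add, add_mul, Finset.sum_add_distrib, hs, ht]
      | tmul x y =>
        simp only [LinearMap.lTensor_tmul, TensorProduct.rid_tmul, map_smul, smul_mul_assoc,
          TensorProduct.map_tmul, LinearMap.mul'_apply]
        simp_rw [← mul_smul_comm, ← map_smul, ← Finset.mul_sum, ← map_sum]
        congr 2
        exact e.sum_repr y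
    have h3 (i) : S.dualActHom ((DualHopf.toDual k H).symm (e.coord i)) (S.tmul r h) =
        S.tmul r 1 * S.gamma (TensorProduct.rid k H ((e.coord i).lTensor H (comul h))) := by
      rw [tmul_one_mul_gamma]; rfl
    simp_rw [h3, mul_assoc]
    rw [← Finset.mul_sum, key]
    refine h2.trans ?_
    rw [slice_tmul, LinearMap.convOne_apply, Algebra.algebraMap_eq_smul_one, mul_smul_comm,
      mul_one, smul_tmul]

/-- The elements `a` of `R #_σ H` with `(1 # h) a ∈ I #_σ H` for all `h` form `(I : H) #_σ H`. -/
theorem gamma_mul_mem_smash_iff {I : TwoSidedIdeal R} {x : S.CrossedProduct} :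
    (∀ h, S.gamma h * x ∈ S.smash I) ↔ x ∈ S.smash (S.colon I) := by
  refine ⟨fun hx => ?_, fun hx h => ?_⟩
  -- The property is stable under `H*`, by `mul_act_mem` with the stable subspaces `Y = γ(H)` and `N
  -- = I #_σ H`.
  · have hact {x : S.CrossedProduct} (hx : ∀ h, S.gamma h * x ∈ S.smash I) (f : DualHopf k H)
        (h : H) : S.gamma h * S.dualActHom f x ∈ S.smash I := by
      refine mul_act_mem S.dualActHom_mul (Y := LinearMap.range S.gamma.ofConv) ?_
        (fun f y hy => S.dualActHom_mem_smash f hy) ?_ f ⟨h, rfl⟩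
      · rintro f _ ⟨h, rfl⟩
        exact ⟨_, (S.dualActHom_gamma f h).symm⟩
      · rintro _ ⟨h, rfl⟩
        exact hx h
    let e := Module.finBasis k H
    rw [S.mem_smash_iff e]
    intro i
    rw [← gamma_mul_tmul_one_mem_smash]
    intro h
    -- This writes the `i`-th coordinate of `x`, placed in `R # 1`, as a sum of translates of `x`
    -- times values of `γ⁻¹`. Since `I #_σ H` absorbs right factors, the coordinate has the same
    -- property as `x`.
    have h1 := S.sum_dualActHom_mul_gamma_inv e
      (S.dualActHom ((DualHopf.toDual k H).symm (e.coord i)) x)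
    rw [slice_counit_dualActHom, LinearEquiv.apply_symm_apply] at h1
    rw [← h1, Finset.mul_sum]
    refine Submodule.sum_mem _ fun j _ => ?_
    rw [← mul_assoc]
    exact S.smash_mul_mem (hact (hact hx _) _ h) _
  · refine Submodule.span_induction (p := fun x _ => S.gamma h * x ∈ S.smash I) ?_ ?_ ?_ ?_ hx
    · rintro _ ⟨r, hr, g, rfl⟩
      rw [← tmul_one_mul_gamma, ← mul_assoc]
      exact S.smash_mul_mem (S.gamma_mul_tmul_one_mem_smash.mpr hr h) _
    · simp
    · intro x y _ _ hx hy; rw [mul_add]; exact add_mem hx hy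
    · intro c x _ hx; rw [mul_smul_comm]; exact Submodule.smul_mem _ c hx

end DualAction

end CrossedSystem

/-! ### Duality: `(R #_σ H) # H*` as a matrix ring over `R` -/

namespace CrossedSystem

section TrivialCocycle
variable {k K A : Type u} [Field k] [Ring K] [Bialgebra k K] [Ring A] [Algebra k A]

/-- The product `(a # f)(b # g) = ∑ a (f₁ · b) # f₂ g` of a smash product. -/
lemma tmul_mul_tmul_of_cocycle_eq_one (D : CrossedSystem k K A) (hD : D.cocycle = 1) (a b : A)
    (f g : K) : D.tmul a f * D.tmul b g =
      TensorProduct.map (LinearMap.mulLeft k a ∘ₗ D.act.flip b) (LinearMap.mulRight k g)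
        (comul f) := by
  have h1 : D.mulAux b = (sharp (toConv (D.actLeft b)) (LinearMap.mul' k K)).ofConv := by
    rw [← ofConv_toConv (D.mulAux b), mulAux_eq_sharp, hD, Units.val_one, mul_one]
  have h2 (t s : K ⊗[k] K) : (a ⊗ₜ[k] (1 : K)) * TensorProduct.map (D.actLeft b)
      (LinearMap.mul' k K)
      (TensorProduct.AlgebraTensorModule.tensorTensorTensorComm k k k k K K K K (t ⊗ₜ s)) =
      TensorProduct.map (LinearMap.mulLeft k a ∘ₗ D.act.flip b)
        (LinearMap.mulRight k (TensorProduct.lid k K (counit.rTensor K s))) t := by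
    induction t with
    | zero => simp
    | add t t' ht ht' => simp only [TensorProduct.add_tmul, map_add, mul_add, ht, ht']
    | tmul x y =>
      induction s with
      | zero => simp
      | add t t' ht ht' =>
        simp only [TensorProduct.tmul_add, map_add, mul_add, ht, ht', TensorProduct.map_tmul,
          LinearMap.mulRight_apply]
      | tmul z w => simp [actLeft, TensorProduct.smul_tmul]
  rw [tmul_mul_tmul, h1, sharp_apply, TensorProduct.comul_tmul]
  refine (h2 _ _).trans ?_
  simp

end TrivialCocycle

section Duality
variable {k H R : Type u} [Field k] [Ring H] [Ring R] [Algebra k R] [HopfAlgebra k H]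
  [FiniteDimensional k H] (S : CrossedSystem k H R)

/-- The map `a # f ↦ op (x ↦ S⁻¹(f) ⇀ (x a))` from `(R #_σ H) # H*`. -/
def dualRep : S.dual.CrossedProduct →ₗ[k] (Module.End k S.CrossedProduct)ᵐᵒᵖ :=
  (LinearMap.mul' k _ ∘ₗ TensorProduct.map (opMulRight (k := k)).toLinearMap
    (opActInv S.dualActHom).ofConv :
      S.CrossedProduct ⊗[k] DualHopf k H →ₗ[k] (Module.End k S.CrossedProduct)ᵐᵒᵖ)

lemma dualRep_tmul (a : S.CrossedProduct) (f : DualHopf k H) :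
    S.dualRep (S.dual.tmul a f) = opMulRight (k := k) a * opActInv S.dualActHom f := rfl

lemma dualRep_tmul_apply (a x : S.CrossedProduct) (f : DualHopf k H) :
    (S.dualRep (S.dual.tmul a f)).unop x =
      S.dualActHom (antipodeInv (k := k) f) (x * a) := rfl

/-- Moving `S⁻¹(f)` past right multiplication by `b` with `opActInv_mul_const` reproduces the smash
product rule `∑ a (f₁ · b) # f₂ g`. -/
lemma dualRep_mul (x y : S.dual.CrossedProduct) :
    S.dualRep (x * y) = S.dualRep x * S.dualRep y := by
  induction x using S.dual.induction_on with
  | zero => simp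
  | add x x' hx hx' => simp only [map_add, add_mul, hx, hx']
  | tmul a f =>
  induction y using S.dual.induction_on with
  | zero => simp
  | add x x' hx hx' => simp only [map_add, mul_add, hx, hx']
  | tmul b g =>
  have h1 := congrArg (fun z : WithConv (DualHopf k H →ₗ[k] (Module.End k S.CrossedProduct)ᵐᵒᵖ) =>
    z f) (opActInv_mul_const S.dualActHom_mul b)
  rw [mul_const_apply] at h1
  have key (t : DualHopf k H ⊗[k] DualHopf k H) :
      LinearMap.mul' k (Module.End k S.CrossedProduct)ᵐᵒᵖ (TensorProduct.map
        (opMulRight (k := k)).toLinearMap (opActInv S.dualActHom).ofConv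
        (TensorProduct.map (LinearMap.mulLeft k a ∘ₗ S.dual.act.flip b)
          (LinearMap.mulRight k g) t)) =
      opMulRight (k := k) a * LinearMap.mul' k (Module.End k S.CrossedProduct)ᵐᵒᵖ
        (TensorProduct.map ((opMulRight (k := k)).toLinearMap ∘ₗ
          S.dualActHom.toLinearMap.flip b) (opActInv S.dualActHom).ofConv t) *
        opActInv S.dualActHom g := by
    induction t with
    | zero => simp
    | add s t hs ht => simp only [map_add, mul_add, add_mul, hs, ht]
    | tmul x y =>
      simp only [TensorProduct.map_tmul, LinearMap.comp_apply, LinearMap.mul'_apply,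
        LinearMap.mulLeft_apply, LinearMap.mulRight_apply, opActInv_map_mul,
        AlgHom.toLinearMap_apply, map_mul, LinearMap.flip_apply, mul_assoc]
      rfl
  rw [tmul_mul_tmul_of_cocycle_eq_one S.dual rfl, dualRep_tmul, dualRep_tmul,
    mul_assoc, ← mul_assoc _ _ (opActInv S.dualActHom g), h1, ← mul_assoc]
  exact key _

/-- Left `R`-linearity: right multiplications commute with left ones, and `H*` acts only on the
factor `H`. The operator is thus determined by its values on `γ(H)`. -/
lemma dualRep_tmul_one_mul (x : S.dual.CrossedProduct) (r : R) (a : S.CrossedProduct) :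
    (S.dualRep x).unop (S.tmul r 1 * a) = S.tmul r 1 * (S.dualRep x).unop a := by
  induction x using S.dual.induction_on with
  | zero => simp
  | add x y hx hy =>
    simp only [map_add, MulOpposite.unop_add, LinearMap.add_apply, mul_add, hx, hy]
  | tmul b f => rw [dualRep_tmul_apply, dualRep_tmul_apply, mul_assoc, dualActHom_tmul_one_mul]

/-- The restriction of the representation `dualRep` to `1 # H`. -/
def dualRepGamma : S.dual.CrossedProduct →ₗ[k] H →ₗ[k] S.CrossedProduct :=
  (LinearMap.lcomp k _ S.gamma.ofConv) ∘ₗ (MulOpposite.opLinearEquiv k).symm.toLinearMap ∘ₗ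
    S.dualRep

lemma dualRepGamma_apply (x : S.dual.CrossedProduct) (h : H) :
    S.dualRepGamma x h = (S.dualRep x).unop (S.gamma h) := rfl

/-- `a ⊗ f ↦ (h ↦ f(h) a)` -/
def tensorDualEquiv : S.CrossedProduct ⊗[k] DualHopf k H ≃ₗ[k] H →ₗ[k] S.CrossedProduct :=
  (TensorProduct.comm k _ _).trans ((TensorProduct.congr (DualHopf.toDual k H)
    (LinearEquiv.refl k S.CrossedProduct)).trans (dualTensorHomEquiv k H S.CrossedProduct))

lemma tensorDualEquiv_tmul (a : S.CrossedProduct) (f : DualHopf k H) (h : H) :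
    S.tensorDualEquiv (a ⊗ₜ f) h = f h • a := by
  simp [tensorDualEquiv]

/-- Both sides equal `∑ γ(h₁) f₁(h₂) (f₂ ⇀ a)`. This separates `γ` as a left convolution factor,
which can be cancelled. -/
lemma dualActHom_gamma_mul (f : DualHopf k H) (h : H) (a : S.CrossedProduct) :
    S.dualActHom f (S.gamma h * a) =
      (S.gamma * toConv (S.tensorDualEquiv (twist (toConv S.dualActHom.toLinearMap) (a ⊗ₜ f))) :
        WithConv (H →ₗ[k] S.CrossedProduct)) h := by
  rw [dualActHom_mul, twist_tmul, LinearMap.convMul_apply]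
  generalize (comul f : DualHopf k H ⊗[k] DualHopf k H) = t
  induction t with
  | zero => simp
  | add s t hs ht =>
    simp only [map_add, hs, ht, TensorProduct.map_add_right, LinearMap.add_apply]
  | tmul f g =>
    simp only [TensorProduct.map_tmul, LinearMap.flip_apply, AlgHom.toLinearMap_apply,
      TensorProduct.comm_tmul, LinearMap.rTensor_tmul, LinearMap.mul'_apply, dualActHom_gamma]
    generalize (comul h : H ⊗[k] H) = t
    induction t with
    | zero => simp
    | add s t hs ht => simp only [map_add, add_mul, hs, ht]
    | tmul x y => simp [tensorDualEquiv_tmul]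

/-- A chain of bijections: `S⁻¹` on `H*`, the operator `twist`, the identification of `A ⊗ H*` with
`Hom(H, A)` for `A = R #_σ H`, and left convolution by the unit `γ`. -/
lemma dualRepGamma_bijective : Function.Bijective S.dualRepGamma := by
  let e : WithConv (H →ₗ[k] S.CrossedProduct) ≃ WithConv (H →ₗ[k] S.CrossedProduct) :=
    Units.mulLeft S.isUnit_gamma.unit
  have he (z) : e z = S.gamma * z := rfl
  let T : S.dual.CrossedProduct ≃ₗ[k] S.CrossedProduct ⊗[k] DualHopf k H :=
    LinearEquiv.lTensor S.CrossedProduct (antipodeInv (k := k) (K := DualHopf k H))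
  have hT (a f) : T (S.dual.tmul a f) = a ⊗ₜ antipodeInv (k := k) f := rfl
  have h : ⇑S.dualRepGamma = WithConv.equiv _ ∘ e ∘ (WithConv.equiv _).symm ∘
      S.tensorDualEquiv ∘ twist (toConv S.dualActHom.toLinearMap) ∘ T := by
    funext x
    simp only [Function.comp_apply, he, WithConv.equiv_apply, WithConv.symm_equiv_apply]
    induction x using S.dual.induction_on with
    | zero => simp
    | add x y hx hy => simp only [map_add, hx, hy, toConv_add, mul_add, ofConv_add]
    | tmul a f =>
      ext1 h
      rw [dualRepGamma_apply, dualRep_tmul_apply, dualActHom_gamma_mul, hT]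
  rw [h]
  exact (WithConv.equiv _).bijective.comp (e.bijective.comp ((WithConv.equiv _).symm.bijective.comp
    (S.tensorDualEquiv.bijective.comp ((twist_bijective S.dualActHom).comp T.bijective))))

variable {ι : Type*} [Fintype ι] [DecidableEq ι] (e : Module.Basis ι k H)

/-- The coefficients of a linear map `H → R #_σ H` with respect to a basis of `H`. -/
def homMatrix (F : H →ₗ[k] S.CrossedProduct) : Matrix ι ι R :=
  .of fun i j => S.slice (e.coord j) (F (e i))

omit [FiniteDimensional k H] in
lemma homMatrix_bijective : Function.Bijective (S.homMatrix e) := by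
  refine ⟨fun F G h => e.ext fun i => ?_, fun M => ?_⟩
  · rw [← S.sum_slice_coord e (F (e i)), ← S.sum_slice_coord e (G (e i))]
    exact Finset.sum_congr rfl fun j _ => congrArg (S.tmul · (e j)) (congrFun₂ h i j)
  · refine ⟨e.constr k fun i => ∑ j, S.tmul (M i j) (e j), ?_⟩
    ext i j
    simp [homMatrix, Finsupp.single_apply]

/-- The duality isomorphism `(R #_σ H) # H* ≃ M_n(R)`. -/
def dualityEquiv : S.dual.CrossedProduct ≃+* Matrix ι ι R where
  __ := Equiv.ofBijective (S.homMatrix e ∘ S.dualRepGamma)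
    ((S.homMatrix_bijective e).comp S.dualRepGamma_bijective)
  map_add' x y := by
    ext i j
    simp [homMatrix]
  map_mul' x y := by
    ext i j
    -- In the opposite ring `x` acts before `y`. Expanding its value over the left `R`-basis
    -- `γ(e_l)` therefore gives the ordinary matrix product, without a transpose.
    have h1 : S.dualRepGamma (x * y) (e i) = ∑ l,
        S.tmul (S.slice (e.coord l) (S.dualRepGamma x (e i))) 1 * S.dualRepGamma y (e l) := by
      rw [dualRepGamma_apply, dualRep_mul, MulOpposite.unop_mul, Module.End.mul_apply,
        ← dualRepGamma_apply]
      conv_lhs => rw [← S.sum_slice_coord e (S.dualRepGamma x (e i))]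
      rw [map_sum]
      refine Finset.sum_congr rfl fun l _ => ?_
      rw [← tmul_one_mul_gamma, dualRep_tmul_one_mul, ← dualRepGamma_apply]
    simp [homMatrix, Matrix.mul_apply, h1, slice_tmul_one_mul]

/-- The element `a # 1` acts by right multiplication by `a`. Hence its matrix has all entries in `I`
exactly when every `γ(e_i) a` is in `I #_σ H`. -/
lemma dualityEquiv_incl (a : S.CrossedProduct) (i j : ι) :
    S.dualityEquiv e (S.dual.incl a) i j = S.slice (e.coord j) (S.gamma (e i) * a) := by
  change S.slice (e.coord j) ((S.dualRep (S.dual.tmul a 1)).unop (S.gamma (e i))) = _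
  rw [dualRep_tmul_apply, antipodeInv_one, map_one]
  rfl

end Duality

end CrossedSystem

/-! ### Radicals under surjections -/

namespace RadicalProperty
variable (r : RadicalProperty.{u})

lemma isGreatest_rad (A : Type u) [NonUnitalRing A] :
    IsGreatest {I : TwoSidedIdeal A | r.prop I} (r.rad A) :=
  (r.exists_greatest A).choose_spec

/-- The image of an ideal under a surjective homomorphism. -/
def mapIdeal {A B : Type u} [NonUnitalRing A] [NonUnitalRing B] (f : A →ₙ+* B)
    (hf : Function.Surjective f) (I : TwoSidedIdeal A) : TwoSidedIdeal B :=
  TwoSidedIdeal.mk' (f '' I) ⟨0, I.zero_mem, map_zero f⟩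
    (by rintro _ _ ⟨x, hx, rfl⟩ ⟨y, hy, rfl⟩; exact ⟨x + y, I.add_mem hx hy, map_add f x y⟩)
    (by rintro _ ⟨x, hx, rfl⟩; exact ⟨-x, I.neg_mem hx, map_neg f x⟩)
    (by
      rintro b _ ⟨y, hy, rfl⟩
      obtain ⟨x, rfl⟩ := hf b
      exact ⟨x * y, I.mul_mem_left _ _ hy, map_mul f x y⟩)
    (by
      rintro _ b ⟨y, hy, rfl⟩
      obtain ⟨x, rfl⟩ := hf b
      exact ⟨y * x, I.mul_mem_right _ _ hy, map_mul f y x⟩)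

lemma mem_mapIdeal {A B : Type u} [NonUnitalRing A] [NonUnitalRing B] {f : A →ₙ+* B}
    (hf : Function.Surjective f) (I : TwoSidedIdeal A) {b : B} :
    b ∈ mapIdeal f hf I ↔ ∃ a ∈ I, f a = b :=
  TwoSidedIdeal.mem_mk' ..

lemma prop_mapIdeal {A B : Type u} [NonUnitalRing A] [NonUnitalRing B] {f : A →ₙ+* B}
    (hf : Function.Surjective f) {I : TwoSidedIdeal A} (hI : r.prop I) :
    r.prop (mapIdeal f hf I) := by
  let g : I →ₙ+* mapIdeal f hf I :=
    { toFun := fun x : I => ⟨f x.1, (mem_mapIdeal hf I).mpr ⟨x.1, x.2, rfl⟩⟩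
      map_zero' := Subtype.ext (map_zero f)
      map_add' x y := Subtype.ext (map_add f x.1 y.1)
      map_mul' x y := Subtype.ext (map_mul f x.1 y.1) }
  refine r.image _ _ g ?_ hI
  rintro ⟨b, hb⟩
  obtain ⟨a, ha, rfl⟩ := (mem_mapIdeal hf I).mp hb
  exact ⟨⟨a, ha⟩, rfl⟩

lemma map_mem_rad {A B : Type u} [NonUnitalRing A] [NonUnitalRing B] {f : A →ₙ+* B}
    (hf : Function.Surjective f) {a : A} (ha : a ∈ r.rad A) : f a ∈ r.rad B :=
  (r.isGreatest_rad B).2 (r.prop_mapIdeal hf (r.isGreatest_rad A).1)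
    ((mem_mapIdeal hf _).mpr ⟨a, ha, rfl⟩)

/-- If the kernel of `f : A → B` is contained in `r(A)`, then `r(A)` is the preimage of `r(B)`. -/
lemma map_mem_rad_iff {A B : Type u} [NonUnitalRing A] [NonUnitalRing B] {f : A →ₙ+* B}
    (hf : Function.Surjective f) (hker : ∀ a, f a = 0 → a ∈ r.rad A) {a : A} :
    f a ∈ r.rad B ↔ a ∈ r.rad A := by
  refine ⟨fun ha => ?_, r.map_mem_rad hf⟩
  let c := (r.rad A).ringCon
  have hc (x y : A) : (x : c.Quotient) = y ↔ x - y ∈ r.rad A := by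
    rw [RingCon.eq]; exact TwoSidedIdeal.rel_iff _ _ _
  have hs (x y : A) (h : f x = f y) : (x : c.Quotient) = y := by
    rw [hc]; exact hker _ (by rw [map_sub, h, sub_self])
  let s := Function.surjInv hf
  have hfs (b : B) : f (s b) = b := Function.surjInv_eq hf b
  -- The projection `A → A / r(A)` factors through `f`. An arbitrary set-theoretic section defines
  -- the factor, since lifts of the same element differ by elements of `r(A)`.
  let g : B →ₙ+* c.Quotient :=
    { toFun b := (s b : c.Quotient)
      map_zero' := hs _ 0 (by rw [hfs, map_zero])
      map_add' x y := hs _ (s x + s y) (by rw [hfs, map_add, hfs, hfs])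
      map_mul' x y := hs _ (s x * s y) (by rw [hfs, map_mul, hfs, hfs]) }
  have hgf (x : A) : g (f x) = (x : c.Quotient) := hs _ _ (hfs _)
  have hg : Function.Surjective g := fun q => by
    obtain ⟨x, rfl⟩ := Quotient.exists_rep q
    exact ⟨f x, hgf x⟩
  -- The image of `r(B)` in `A / r(A)` is an `r`-ideal, hence zero.
  have h1 := r.quotient A (r.rad A) (r.isGreatest_rad A) _
    (r.prop_mapIdeal hg (r.isGreatest_rad B).1)
  have h2 : g (f a) ∈ mapIdeal g hg (r.rad B) := (mem_mapIdeal hg _).mpr ⟨_, ha, rfl⟩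
  rw [h1, TwoSidedIdeal.mem_bot, hgf] at h2
  simpa using (hc a 0).mp h2

lemma ringEquiv_mem_rad_iff {A B : Type u} [NonUnitalRing A] [NonUnitalRing B] (e : A ≃+* B)
    {a : A} : e a ∈ r.rad B ↔ a ∈ r.rad A :=
  r.map_mem_rad_iff (f := (e : A →ₙ+* B)) e.surjective fun a ha => by
    have : a = 0 := e.injective (ha.trans (map_zero e).symm)
    rw [this]; exact (r.rad A).zero_mem

end RadicalProperty

/-! ### Quotients of twisted module algebras -/

namespace CrossedSystem

section Quotient
variable {k H R Q : Type u} [Field k] [Ring H] [Bialgebra k H] [Ring R] [Algebra k R] [Ring Q]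
  [Algebra k Q] (S : CrossedSystem k H R)

/-- The action need not be a module action, but the twisted module condition writes `l · (h · x)` as
a sum of terms `σ(l₁, h₁) (l₂ h₂ · x) σ⁻¹(l₃, h₃)`, each in the two-sided ideal `I`. -/
lemma act_mem_colon {I : TwoSidedIdeal R} {x : R} (hx : x ∈ S.colon I) (h : H) :
    S.act h x ∈ S.colon I := by
  rw [mem_colon] at hx ⊢
  intro l
  have h1 := congrArg (fun z : WithConv (H ⊗[k] H →ₗ[k] R) => z (l ⊗ₜ h)) (S.act_act x)
  have h2 : S.act l (S.act h x) = (S.cocycle.val * toConv (S.act.flip x ∘ₗ LinearMap.mul' k H) *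
    S.cocycle.inv : WithConv (H ⊗[k] H →ₗ[k] R)) (l ⊗ₜ h) := h1
  rw [h2, LinearMap.convMul_apply]
  generalize (comul (l ⊗ₜ[k] h) : (H ⊗[k] H) ⊗[k] (H ⊗[k] H)) = t
  induction t with
  | zero => rw [map_zero, map_zero]; exact I.zero_mem
  | add s t hs ht => rw [map_add, map_add]; exact I.add_mem hs ht
  | tmul a b =>
    refine I.mul_mem_right _ _ ?_
    change (S.cocycle.val * toConv (S.act.flip x ∘ₗ LinearMap.mul' k H) :
      WithConv (H ⊗[k] H →ₗ[k] R)) a ∈ I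
    rw [LinearMap.convMul_apply]
    generalize (comul a : (H ⊗[k] H) ⊗[k] (H ⊗[k] H)) = t
    induction t with
    | zero => rw [map_zero, map_zero]; exact I.zero_mem
    | add s t hs ht => rw [map_add, map_add]; exact I.add_mem hs ht
    | tmul c d => exact I.mul_mem_left _ _ (hx _)

/-- Composition with an algebra homomorphism, as a homomorphism of convolution monoids. -/
def convMap {C : Type u} [AddCommGroup C] [Module k C] [Coalgebra k C] (π : R →ₐ[k] Q) :
    WithConv (C →ₗ[k] R) →* WithConv (C →ₗ[k] Q) where
  toFun f := toConv (π.toLinearMap ∘ₗ f.ofConv)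
  map_one' := by ext x; simp
  map_mul' f g := congrArg toConv (LinearMap.algHom_comp_convMul_distrib π f g)

/-- A surjection of `k`-algebras whose kernel is stable under the weak action carries the structure
of a twisted module algebra over to its target. -/
def quotient (π : R →ₐ[k] Q) (hπ : Function.Surjective π)
    (hS : ∀ h x, π x = 0 → π (S.act h x) = 0) : CrossedSystem k H Q :=
  -- A linear section makes the induced action bilinear at once; `hact` shows that the choice of
  -- section does not matter.
  let s := Classical.choose (π.toLinearMap.exists_rightInverse_of_surjective
    (LinearMap.range_eq_top.mpr hπ))
  have hs : π.toLinearMap ∘ₗ s = LinearMap.id := Classical.choose_spec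
    (π.toLinearMap.exists_rightInverse_of_surjective (LinearMap.range_eq_top.mpr hπ))
  let act : H →ₗ[k] Q →ₗ[k] Q := (S.act.compr₂ π.toLinearMap).compl₂ s
  have hact (h : H) (x : R) : act h (π x) = π (S.act h x) := by
    have h1 : π (s (π x) - x) = 0 := by
      rw [map_sub, sub_eq_zero]; exact LinearMap.congr_fun hs (π x)
    have h2 := hS h _ h1
    rw [map_sub, map_sub, sub_eq_zero] at h2
    exact h2
  have hflip (x : R) : act.flip (π x) = π.toLinearMap ∘ₗ S.act.flip x :=
    LinearMap.ext fun h => hact h x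
  { act := act
    one_act := fun q => by
      obtain ⟨x, rfl⟩ := hπ q
      rw [hact, one_act]
    act_one := fun h => by
      rw [← map_one π, hact, S.act_one, AlgHom.commutes]
    act_mul := fun p q => by
      obtain ⟨x, rfl⟩ := hπ p
      obtain ⟨y, rfl⟩ := hπ q
      rw [← map_mul, hflip, hflip, hflip]
      exact (congrArg (convMap π) (S.act_mul x y)).trans (map_mul _ _ _)
    cocycle := Units.map (convMap π) S.cocycle
    cocycle_one_left := fun h => by
      refine (congrArg π (S.cocycle_one_left h)).trans (π.commutes _)
    cocycle_one_right := fun h => by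
      refine (congrArg π (S.cocycle_one_right h)).trans (π.commutes _)
    act_act := fun q => by
      obtain ⟨x, rfl⟩ := hπ q
      have h1 : toConv (TensorProduct.lift (LinearMap.compl₂ act (act.flip (π x)))) =
          convMap π (toConv (TensorProduct.lift (LinearMap.compl₂ S.act (S.act.flip x)))) := by
        ext h l
        simp [hact, convMap]
      rw [h1, S.act_act, map_mul, map_mul, hflip]
      rfl
    cocycle_mul := by
      have h1 : toConv (TensorProduct.lift (LinearMap.compl₂ act
          (Units.map (convMap π) S.cocycle).val.ofConv)) =
          convMap π (toConv (TensorProduct.lift (LinearMap.compl₂ S.act S.cocycle.val.ofConv))) := by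
        ext h l m
        simp [hact, convMap]
      have h2 := congrArg (convMap π) S.cocycle_mul
      rw [map_mul, map_mul] at h2
      rw [h1]
      exact h2 }

variable {π : R →ₐ[k] Q} (hπ : Function.Surjective π)
  (hS : ∀ h x, π x = 0 → π (S.act h x) = 0)

lemma quotient_act (h : H) (x : R) : (S.quotient π hπ hS).act h (π x) = π (S.act h x) := by
  have hs := Classical.choose_spec (π.toLinearMap.exists_rightInverse_of_surjective
    (LinearMap.range_eq_top.mpr hπ))
  set s := Classical.choose (π.toLinearMap.exists_rightInverse_of_surjective
    (LinearMap.range_eq_top.mpr hπ))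
  have h1 : π (s (π x) - x) = 0 := by
    rw [map_sub, sub_eq_zero]; exact LinearMap.congr_fun hs (π x)
  have h2 := hS h _ h1
  rw [map_sub, map_sub, sub_eq_zero] at h2
  exact h2

/-- The homomorphism `r # h ↦ π(r) # h`. -/
def quotientMap : S.CrossedProduct →ₗ[k] (S.quotient π hπ hS).CrossedProduct :=
  (π.toLinearMap.rTensor H : R ⊗[k] H →ₗ[k] Q ⊗[k] H)

lemma quotientMap_tmul (x : R) (h : H) :
    S.quotientMap hπ hS (S.tmul x h) = (S.quotient π hπ hS).tmul (π x) h := rfl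

lemma quotientMap_mul (x y : S.CrossedProduct) :
    S.quotientMap hπ hS (x * y) = S.quotientMap hπ hS x * S.quotientMap hπ hS y := by
  induction x using S.induction_on with
  | zero => simp
  | add x x' hx hx' => simp only [map_add, add_mul, hx, hx']
  | tmul a h =>
  induction y using S.induction_on with
  | zero => simp
  | add x x' hx hx' => simp only [map_add, mul_add, hx, hx']
  | tmul b g =>
  -- `mulAux` is a convolution product with values in the ordinary tensor product algebra, and `Φ`
  -- is an algebra map there. It therefore suffices to compare the three convolution factors.
  let Φ : R ⊗[k] H →ₐ[k] Q ⊗[k] H := Algebra.TensorProduct.map π (AlgHom.id k H)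
  have h1 : toConv ((S.quotient π hπ hS).mulAux (π b)) = convMap Φ (toConv (S.mulAux b)) := by
    have e1 : toConv (S.mulAux b) = toConv (inl.toLinearMap ∘ₗ S.actLeft b) *
      (toConv (inl.toLinearMap ∘ₗ S.cocycle.val.ofConv) *
        toConv (inr.toLinearMap ∘ₗ LinearMap.mul' k H)) := rfl
    have e2 : toConv ((S.quotient π hπ hS).mulAux (π b)) =
      toConv (inl.toLinearMap ∘ₗ (S.quotient π hπ hS).actLeft (π b)) *
      (toConv (inl.toLinearMap ∘ₗ (S.quotient π hπ hS).cocycle.val.ofConv) *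
        toConv (inr.toLinearMap ∘ₗ LinearMap.mul' k H)) := rfl
    rw [e1, e2, map_mul, map_mul]
    refine congrArg₂ (· * ·) ?_ (congrArg₂ (· * ·) ?_ ?_)
    · ext h g
      simp [convMap, actLeft, quotient_act, Φ]
    · ext h g
      simp [convMap, quotient, Φ]
    · ext h g
      simp [convMap, Φ]
  have h2 : (S.quotient π hπ hS).mulAux (π b) (h ⊗ₜ g) = Φ (S.mulAux b (h ⊗ₜ g)) :=
    congrArg (fun z : WithConv (H ⊗[k] H →ₗ[k] Q ⊗[k] H) => z (h ⊗ₜ g)) h1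
  rw [quotientMap_tmul, quotientMap_tmul, tmul_mul_tmul, tmul_mul_tmul, h2]
  have h3 : π a ⊗ₜ[k] (1 : H) = Φ (a ⊗ₜ 1) := by simp [Φ]
  rw [h3, ← map_mul]
  rfl

lemma slice_quotientMap (f : H →ₗ[k] k) (x : S.CrossedProduct) :
    (S.quotient π hπ hS).slice f (S.quotientMap hπ hS x) = π (S.slice f x) := by
  induction x using S.induction_on with
  | zero => simp
  | add x y hx hy => simp only [map_add, hx, hy]
  | tmul r h => rw [quotientMap_tmul, slice_tmul, slice_tmul, map_smul]

lemma quotientMap_surjective : Function.Surjective (S.quotientMap hπ hS) :=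
  LinearMap.rTensor_surjective H hπ

lemma quotientMap_eq_zero_iff [FiniteDimensional k H] {I : TwoSidedIdeal R}
    (hI : ∀ x, π x = 0 ↔ x ∈ I) {x : S.CrossedProduct} :
    S.quotientMap hπ hS x = 0 ↔ x ∈ S.smash I := by
  let e := Module.finBasis k H
  rw [S.mem_smash_iff e]
  refine ⟨fun h i => ?_, fun h => ?_⟩
  · rw [← hI, ← S.slice_quotientMap hπ hS, h, map_zero]
  · rw [← sum_slice_coord _ e (S.quotientMap hπ hS x)]
    refine Finset.sum_eq_zero fun i _ => ?_
    rw [slice_quotientMap, (hI _).mpr (h i), zero_tmul]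

end Quotient

end CrossedSystem

/-! ### The three assertions -/

namespace RadicalProperty
variable {k H R : Type u} [Field k] [Ring H] [Ring R] [Algebra k R] [HopfAlgebra k H]
  [FiniteDimensional k H] (r : RadicalProperty.{u}) (S : CrossedSystem k H R)

/-- Transporting membership along `dualityEquiv` turns it into a condition on matrix entries, namely
that `γ(e_i) a` lies in `r(R) #_σ H` for each basis vector; linearity extends this to all `γ(h) a`.
-/
theorem smash_radH_eq_barRadH_dual (hM : r.MatrixCondition k H) :
    (S.smash (r.radH S) : Set S.CrossedProduct) = r.barRadH S.dual := by
  ext a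
  let e := Module.finBasis k H
  change a ∈ S.smash (S.colon (r.rad R)) ↔ a ∈ (r.rad S.dual.CrossedProduct).comap S.dual.incl
  rw [TwoSidedIdeal.mem_comap, ← r.ringEquiv_mem_rad_iff (S.dualityEquiv e), hM R S,
    TwoSidedIdeal.mem_matrix, ← S.gamma_mul_mem_smash_iff]
  simp only [S.dualityEquiv_incl e, ← S.mem_smash_iff e]
  refine ⟨fun h i => h _, fun h g => ?_⟩
  rw [← e.sum_repr g, map_sum, Finset.sum_mul]
  refine Submodule.sum_mem _ fun i _ => ?_
  rw [map_smul, smul_mul_assoc]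
  exact Submodule.smul_mem _ _ (h i)

theorem smash_radH_subset_rad (hM : r.MatrixCondition k H)
    (hd : r.BarRadHLe k (DualHopf k H)) :
    (S.smash (r.radH S) : Set S.CrossedProduct) ⊆ r.rad S.CrossedProduct := by
  intro a ha
  rw [r.smash_radH_eq_barRadH_dual S hM] at ha
  have h1 : a ∈ S.dual.colon (r.rad S.CrossedProduct) := hd _ _ ha
  rw [CrossedSystem.mem_colon] at h1
  rw [← S.dual.one_act a]
  exact h1 1

theorem barRadH_eq_radH (hM : r.MatrixCondition k H) (hb : r.BarRadHLe k H)
    (hd : r.BarRadHLe k (DualHopf k H)) : r.barRadH S = r.radH S := by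
  refine le_antisymm (hb _ _) fun x hx => ?_
  rw [barRadH, TwoSidedIdeal.mem_comap]
  exact r.smash_radH_subset_rad S hM hd (S.tmul_mem_smash hx 1)

/-- One inclusion is `smash_radH_subset_rad`. The other is checked in the crossed product over `R /
r_H(R)`, whose radical vanishes by `h0`. -/
theorem rad_eq_smash_radH (hM : r.MatrixCondition k H) (hb : r.BarRadHLe k H)
    (hd : r.BarRadHLe k (DualHopf k H))
    (h0 : ∀ (R : Type u) [Ring R] [Algebra k R] (S : CrossedSystem k H R),
      r.radH S = ⊥ → r.rad S.CrossedProduct = ⊥) :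
    (r.rad S.CrossedProduct : Set S.CrossedProduct) = S.smash (r.radH S) := by
  refine Set.Subset.antisymm (fun x hx => ?_) (r.smash_radH_subset_rad S hM hd)
  let Q := (r.radH S).ringCon.Quotient
  let π : R →ₐ[k] Q := RingCon.mkₐ k (r.radH S).ringCon
  have hπ : Function.Surjective π := Quotient.exists_rep
  have hI (x : R) : π x = 0 ↔ x ∈ r.radH S := by
    rw [← map_zero π, TwoSidedIdeal.mem_iff]
    exact RingCon.eq _
  have hS (h : H) (x : R) (hx : π x = 0) : π (S.act h x) = 0 :=
    (hI _).mpr (S.act_mem_colon ((hI x).mp hx) h)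
  let F : S.CrossedProduct →ₙ+* (S.quotient π hπ hS).CrossedProduct :=
    { S.quotientMap hπ hS with
      map_zero' := map_zero _
      map_mul' := S.quotientMap_mul hπ hS }
  have hF : Function.Surjective F := S.quotientMap_surjective hπ hS
  have hker (y) : F y = 0 ↔ y ∈ S.smash (r.radH S) := S.quotientMap_eq_zero_iff hπ hS hI
  -- The inclusion already proved places the kernel of `F` inside the radical, which is what lets
  -- membership be lifted back.
  have hrad {y} : F y ∈ r.rad _ ↔ y ∈ r.rad S.CrossedProduct := r.map_mem_rad_iff hF fun y hy =>
    r.smash_radH_subset_rad S hM hd ((hker y).mp hy)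
  -- Here `r_H` is replaced by `r̄_H` on both algebras, because `r̄_H` is defined inside the crossed
  -- product, where `hrad` applies.
  have h1 : r.radH (S.quotient π hπ hS) = ⊥ := by
    rw [eq_bot_iff]
    intro q hq
    replace hq := (SetLike.ext_iff.mp (r.barRadH_eq_radH _ hM hb hd) q).mpr hq
    obtain ⟨y, rfl⟩ := hπ q
    rw [TwoSidedIdeal.mem_bot, hI, ← r.barRadH_eq_radH S hM hb hd]
    rw [barRadH, TwoSidedIdeal.mem_comap] at hq ⊢
    exact hrad.mp hq
  rw [SetLike.mem_coe, ← hrad, h0 _ _ h1, TwoSidedIdeal.mem_bot, hker] at hx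
  exact hx

end RadicalProperty

end HopfRadical

end

theorem proposition2p4 {k H : Type u} [Field k] [Ring H] [HopfAlgebra k H]
    [FiniteDimensional k H] (r : HopfRadical.RadicalProperty.{u}) (hr : r.IsHereditary)
    (hM : r.MatrixCondition k H) :
    (∀ (R : Type u) [Ring R] [Algebra k R] (S : HopfRadical.CrossedSystem k H R),
      (S.smash (r.radH S) : Set S.CrossedProduct) = r.barRadH S.dual) ∧
    (r.BarRadHLe k H → r.BarRadHLe k (HopfRadical.DualHopf k H) →
      (∀ (R : Type u) [Ring R] [Algebra k R] (S : HopfRadical.CrossedSystem k H R),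
        r.barRadH S = r.radH S ∧
        (S.smash (r.radH S) : Set S.CrossedProduct) ⊆ r.rad S.CrossedProduct) ∧
      ((∀ (R : Type u) [Ring R] [Algebra k R] (S : HopfRadical.CrossedSystem k H R),
          r.radH S = ⊥ → r.rad S.CrossedProduct = ⊥) ↔
        ∀ (R : Type u) [Ring R] [Algebra k R] (S : HopfRadical.CrossedSystem k H R),
          (r.rad S.CrossedProduct : Set S.CrossedProduct) = S.smash (r.radH S))) := by
  refine ⟨fun R _ _ S => r.smash_radH_eq_barRadH_dual S hM, fun hb hd => ⟨fun R _ _ S =>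
    ⟨r.barRadH_eq_radH S hM hb hd, r.smash_radH_subset_rad S hM hd⟩,
    fun h0 R _ _ S => r.rad_eq_smash_radH S hM hb hd h0, fun h R _ _ S hS => ?_⟩⟩
  -- When `r_H(R) = 0`, the given equality places `x` in `0 #_σ H`, so all its coordinates vanish.
  rw [eq_bot_iff]
  intro x hx
  have hx' : x ∈ S.smash (r.radH S) := (h R S).subset hx
  rw [hS] at hx'
  rw [TwoSidedIdeal.mem_bot, ← S.sum_slice_coord (Module.finBasis k H) x]
  refine Finset.sum_eq_zero fun i _ => ?_
  have hi := S.slice_mem_of_mem_smash ((Module.finBasis k H).coord i) hx'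
  rw [TwoSidedIdeal.mem_bot] at hi
  rw [hi, S.zero_tmul]
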